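/- Let $\mathcal{Q}$ be a finite quiver and $\mathbb{F}$ a field. Put $k=\mathbb{F}\mathcal{Q}_0$ (the ring spanned by the vertices, which are orthogonal idempotents) and $V=\mathbb{F}\mathcal{Q}_1$ (the $k$-bimodule spanned by the arrows), so that the tensor algebra $T_k(V)$ is the path algebra $\mathbb{F}\mathcal{Q}$. Let $R\subseteq V\otimes_k V$ be a sub-$k$-bimodule and let $A=T_k(V)/(R)$. Write $A^e=A\otimes_{\mathbb{F}}A^{op}$. Let $K(A)$ be the bimodule Koszul complex of $A$, with terms $K(A)_p=A\otimes_k W_p\otimes_k A$, where $W_0=k$, $W_1=V$ and $W_p=\bigcap_{i+2+j=p}V^{\otimes_k i}\otimes_k R\otimes_k V^{\otimes_k j}$ for $p\geq 2$, and with differential $$d(a\otimes x_1\cdots x_p\otimes a')=ax_1\otimes x_2\cdots x_p\otimes a'+(-1)^p\,a\otimes x_1\cdots x_{p-1}\otimes x_pa'.$$ Let $n$ be an integer with $0\leq n\leq 3$, and assume both of the following. 1. $A$ is $n$-Calabi–Yau in the sense of Ginzburg: $A$ has a bounded resolution by finitely generated projective $A$-bimodules, and $\mathrm{RHom}_{A^e}(A,A^e)\cong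 A[-n]$ in the bounded derived category of $A$-bimodules. 2. $A$ is Koszul complex Calabi–Yau of dimension $n$ ($n$-Kc-Calabi–Yau): $K(A)$ has length $n$, that is, $K(A)_n\neq 0$ and $K(A)_p=0$ for all $p>n$, and $\mathrm{RHom}_{A^e}(K(A),A^e)\cong K(A)[-n]$ in the bounded derived category of $A$-bimodules. Then $A$ is Koszul, that is, $H_p(K(A))=0$ for all $p>1$. -/

import Mathlib

open scoped TensorProduct
open CategoryTheory

universe u

noncomputable section

namespace QuadraticQuiver

/-! ## Path algebras -/

section PathAlgebra

variable (F : Type u) [Field F] (Q : Type u) [Quiver.{u} Q] [Fintype Q]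

/-- The defining relations of the path algebra: the vertices `e i` are orthogonal idempotents
with sum `1`, and `e_{t(α)} α = α = α e_{s(α)}` for each arrow `α`. Paths are composed from right
to left, so `α β = 0` unless `t(β) = s(α)`. -/
inductive PathRel : FreeAlgebra F (Q ⊕ Quiver.Total Q) → FreeAlgebra F (Q ⊕ Quiver.Total Q) → Prop
  | idem (i : Q) :
      PathRel (FreeAlgebra.ι F (Sum.inl i) * FreeAlgebra.ι F (Sum.inl i))
        (FreeAlgebra.ι F (Sum.inl i))
  | orth (i j : Q) (h : i ≠ j) :
      PathRel (FreeAlgebra.ι F (Sum.inl i) * FreeAlgebra.ι F (Sum.inl j)) 0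
  | one : PathRel (∑ i : Q, FreeAlgebra.ι F (Sum.inl i)) 1
  | target (a : Quiver.Total Q) :
      PathRel (FreeAlgebra.ι F (Sum.inl a.right) * FreeAlgebra.ι F (Sum.inr a))
        (FreeAlgebra.ι F (Sum.inr a))
  | source (a : Quiver.Total Q) :
      PathRel (FreeAlgebra.ι F (Sum.inr a) * FreeAlgebra.ι F (Sum.inl a.left))
        (FreeAlgebra.ι F (Sum.inr a))

/-- The path algebra `F Q = T_k(V)` of a quiver `Q` with finitely many vertices, by generators
(vertices and arrows) and relations. -/
def PathAlgebra : Type u := RingQuot (PathRel F Q)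

instance : Ring (PathAlgebra F Q) := inferInstanceAs (Ring (RingQuot (PathRel F Q)))
instance : Algebra F (PathAlgebra F Q) := inferInstanceAs (Algebra F (RingQuot (PathRel F Q)))

namespace PathAlgebra

variable {Q}

/-- The trivial path at the vertex `i`. -/
def e (i : Q) : PathAlgebra F Q := RingQuot.mkAlgHom F (PathRel F Q) (FreeAlgebra.ι F (Sum.inl i))

/-- An arrow, as an element of the path algebra. -/
def arr (a : Quiver.Total Q) : PathAlgebra F Q :=
  RingQuot.mkAlgHom F (PathRel F Q) (FreeAlgebra.ι F (Sum.inr a))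

lemma e_mul_self (i : Q) : e F i * e F i = e F i := by
  have := RingQuot.mkAlgHom_rel F (PathRel.idem (F := F) i)
  rwa [map_mul] at this

lemma e_mul_ne {i j : Q} (h : i ≠ j) : e F i * e F j = 0 := by
  have := RingQuot.mkAlgHom_rel F (PathRel.orth (F := F) i j h)
  rwa [map_mul, map_zero] at this

lemma sum_e : ∑ i : Q, e F i = 1 := by
  have := RingQuot.mkAlgHom_rel F (PathRel.one (F := F) (Q := Q))
  rwa [map_sum, map_one] at this

lemma e_mul_arr (a : Quiver.Total Q) : e F a.right * arr F a = arr F a := by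
  have := RingQuot.mkAlgHom_rel F (PathRel.target (F := F) a)
  rwa [map_mul] at this

lemma arr_mul_e (a : Quiver.Total Q) : arr F a * e F a.left = arr F a := by
  have := RingQuot.mkAlgHom_rel F (PathRel.source (F := F) a)
  rwa [map_mul] at this

variable (Q) in
/-- The vertex space `k`. -/
def vertexSpace : Submodule F (PathAlgebra F Q) := Submodule.span F (Set.range (e F))

variable (Q) in
/-- The arrow space `V`. -/
def arrowSpace : Submodule F (PathAlgebra F Q) := Submodule.span F (Set.range (arr F))

variable {F}

lemma induct {P : PathAlgebra F Q → Prop} (he : ∀ i, P (e F i)) (ha : ∀ a, P (arr F a))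
    (hc : ∀ c : F, P (algebraMap F _ c)) (hadd : ∀ x y, P x → P y → P (x + y))
    (hmul : ∀ x y, P x → P y → P (x * y)) (x : PathAlgebra F Q) : P x := by
  obtain ⟨y, rfl⟩ := RingQuot.mkAlgHom_surjective F (PathRel F Q) x
  induction y using FreeAlgebra.induction with
  | grade0 r => rw [AlgHom.commutes]; exact hc r
  | grade1 x => cases x with
    | inl i => exact he i
    | inr a => exact ha a
  | mul a b h1 h2 => rw [map_mul]; exact hmul _ _ h1 h2
  | add a b h1 h2 => rw [map_add]; exact hadd _ _ h1 h2

variable (F)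

/-- The universal property of the path algebra. -/
def lift {B : Type u} [Ring B] [Algebra F B] (f : Q → B) (g : Quiver.Total Q → B)
    (h1 : ∀ i, f i * f i = f i) (h2 : ∀ i j, i ≠ j → f i * f j = 0) (h3 : ∑ i, f i = 1)
    (h4 : ∀ a : Quiver.Total Q, f a.right * g a = g a)
    (h5 : ∀ a : Quiver.Total Q, g a * f a.left = g a) :
    PathAlgebra F Q →ₐ[F] B :=
  RingQuot.liftAlgHom F ⟨FreeAlgebra.lift F (Sum.elim f g), by
    intro x y h
    cases h with
    | idem i => simpa using h1 i
    | orth i j h => simpa using h2 i j h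
    | one => simpa using h3
    | target a => simpa using h4 a
    | source a => simpa using h5 a⟩

section

variable {B : Type u} [Ring B] [Algebra F B] (f : Q → B) (g : Quiver.Total Q → B)

lemma lift_e (h1 h2 h3 h4 h5) (i : Q) : lift F f g h1 h2 h3 h4 h5 (e F i) = f i := by
  unfold lift e
  exact (RingQuot.liftAlgHom_mkAlgHom_apply _ _ _ _).trans (by simp)

lemma lift_arr (h1 h2 h3 h4 h5) (a : Quiver.Total Q) :
    lift F f g h1 h2 h3 h4 h5 (arr F a) = g a := by
  unfold lift arr
  exact (RingQuot.liftAlgHom_mkAlgHom_apply _ _ _ _).trans (by simp)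

end

open Classical in
/-- The character of the path algebra attached to the vertex `j`. -/
def char (j : Q) : PathAlgebra F Q →ₐ[F] F :=
  lift F (fun i => if i = j then 1 else 0) (fun _ => 0)
    (by intro i; simp) (by intro i k h; grind) (by simp) (by simp) (by simp)

open Classical in
lemma char_e (i j : Q) : char F j (e F i) = if i = j then 1 else 0 := by
  unfold char; exact lift_e ..

lemma char_arr (j : Q) (a : Quiver.Total Q) : char F j (arr F a) = 0 := by
  unfold char; exact lift_arr ..

lemma tri_mul {B : Type u} [Ring B] {p q r p' q' r' p'' q'' r'' : B} (h1 : p * p' = p'')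
    (h2 : p * q' + q * r' = q'') (h3 : r * r' = r'') :
    !![p, q; 0, r] * !![p', q'; 0, r'] = !![p'', q''; 0, r''] := by
  rw [Matrix.mul_fin_two, ← h1, ← h2, ← h3]; simp

open Classical in
/-- Auxiliary matrix representation, whose upper right corner is the left derivative. -/
def repL (a : Quiver.Total Q) : PathAlgebra F Q →ₐ[F] Matrix (Fin 2) (Fin 2) (PathAlgebra F Q) :=
  lift F (fun i => !![if i = a.right then 1 else 0, 0; 0, e F i])
      (fun b => !![0, if a = b then e F b.left else 0; 0, arr F b])
    (fun i => tri_mul (by split_ifs <;> simp) (by simp) (e_mul_self F i))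
    (fun i j h => (tri_mul (by rw [Matrix.zero_apply]; split_ifs <;> grind) (by simp) (e_mul_ne F h)).trans (Matrix.eta_fin_two 0).symm)
    (by
      ext k l
      rw [Matrix.sum_apply]
      fin_cases k <;> fin_cases l <;> simp [sum_e])
    (fun b => tri_mul (by simp) (by by_cases h : a = b <;> simp [h]) (e_mul_arr F b))
    (fun b => tri_mul (by simp) (by by_cases h : a = b <;> simp [h, e_mul_self]) (arr_mul_e F b))

open Classical in
/-- Auxiliary matrix representation, whose upper right corner is the right derivative. -/
def repR (a : Quiver.Total Q) : PathAlgebra F Q →ₐ[F] Matrix (Fin 2) (Fin 2) (PathAlgebra F Q) :=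
  lift F (fun i => !![e F i, 0; 0, if i = a.left then 1 else 0])
      (fun b => !![arr F b, if a = b then e F b.right else 0; 0, 0])
    (fun i => tri_mul (e_mul_self F i) (by simp) (by split_ifs <;> simp))
    (fun i j h => (tri_mul (e_mul_ne F h) (by simp) (by rw [Matrix.zero_apply]; split_ifs <;> grind)).trans (Matrix.eta_fin_two 0).symm)
    (by
      ext k l
      rw [Matrix.sum_apply]
      fin_cases k <;> fin_cases l <;> simp [sum_e])
    (fun b => tri_mul (e_mul_arr F b) (by by_cases h : a = b <;> simp [h, e_mul_self]) (by simp))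
    (fun b => tri_mul (arr_mul_e F b) (by by_cases h : a = b <;> simp [h]) (by simp))

/-- The left derivative `∂_α`: the linear map with `∂_α (α p) = p` for each path `p` that starts
where `α` can be composed, and `∂_α p = 0` for each path `p` whose leftmost factor is not `α`. -/
def derivL (a : Quiver.Total Q) : PathAlgebra F Q →ₗ[F] PathAlgebra F Q :=
  (Matrix.entryLinearMap F (PathAlgebra F Q) (0 : Fin 2) (1 : Fin 2)) ∘ₗ (repL F a).toLinearMap

/-- The right derivative: the linear map with `p α ↦ p` that kills each path whose rightmost
factor is not `α`. -/
def derivR (a : Quiver.Total Q) : PathAlgebra F Q →ₗ[F] PathAlgebra F Q :=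
  (Matrix.entryLinearMap F (PathAlgebra F Q) (0 : Fin 2) (1 : Fin 2)) ∘ₗ (repR F a).toLinearMap

lemma derivL_def (a : Quiver.Total Q) (x : PathAlgebra F Q) : derivL F a x = repL F a x 0 1 := rfl
lemma derivR_def (a : Quiver.Total Q) (x : PathAlgebra F Q) : derivR F a x = repR F a x 0 1 := rfl

lemma repL_entries (a : Quiver.Total Q) (x : PathAlgebra F Q) :
    repL F a x 1 0 = 0 ∧ repL F a x 1 1 = x ∧
      repL F a x 0 0 = algebraMap F _ (char F a.right x) := by
  induction x using induct with
  | he i =>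
    rw [repL, lift_e, char_e]
    simp [apply_ite (algebraMap F (PathAlgebra F Q))]
  | ha b => rw [repL, lift_arr, char_arr]; simp
  | hc c => simp [Matrix.algebraMap_matrix_apply]
  | hadd x y hx hy => simp [hx, hy]
  | hmul x y hx hy => simp [Matrix.mul_apply, Fin.sum_univ_two, hx, hy]

lemma repR_entries (a : Quiver.Total Q) (x : PathAlgebra F Q) :
    repR F a x 1 0 = 0 ∧ repR F a x 0 0 = x ∧
      repR F a x 1 1 = algebraMap F _ (char F a.left x) := by
  induction x using induct with
  | he i =>
    rw [repR, lift_e, char_e]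
    simp [apply_ite (algebraMap F (PathAlgebra F Q))]
  | ha b => rw [repR, lift_arr, char_arr]; simp
  | hc c => simp [Matrix.algebraMap_matrix_apply]
  | hadd x y hx hy => simp [hx, hy]
  | hmul x y hx hy => simp [Matrix.mul_apply, Fin.sum_univ_two, hx, hy]

lemma derivL_mul (a : Quiver.Total Q) (x y : PathAlgebra F Q) :
    derivL F a (x * y) = derivL F a x * y + char F a.right x • derivL F a y := by
  rw [derivL_def, map_mul, Matrix.mul_apply, Fin.sum_univ_two, (repL_entries F a x).2.2,
    (repL_entries F a y).2.1, ← Algebra.smul_def, add_comm]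
  rfl

lemma derivR_mul (a : Quiver.Total Q) (x y : PathAlgebra F Q) :
    derivR F a (x * y) = x * derivR F a y + char F a.left y • derivR F a x := by
  rw [derivR_def, map_mul, Matrix.mul_apply, Fin.sum_univ_two, (repR_entries F a x).2.1,
    (repR_entries F a y).2.2, ← Algebra.commutes, ← Algebra.smul_def]
  rfl

lemma derivL_e (a : Quiver.Total Q) (i : Q) : derivL F a (e F i) = 0 := by
  rw [derivL_def, repL, lift_e]; simp

lemma derivR_e (a : Quiver.Total Q) (i : Q) : derivR F a (e F i) = 0 := by
  rw [derivR_def, repR, lift_e]; simp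

open Classical in
lemma derivL_arr (a b : Quiver.Total Q) :
    derivL F a (arr F b) = if a = b then e F b.left else 0 := by
  rw [derivL_def, repL, lift_arr]; simp

open Classical in
lemma derivR_arr (a b : Quiver.Total Q) :
    derivR F a (arr F b) = if a = b then e F b.right else 0 := by
  rw [derivR_def, repR, lift_arr]; simp

lemma one_mem_vertexSpace : (1 : PathAlgebra F Q) ∈ vertexSpace F Q := by
  rw [← sum_e]
  exact Submodule.sum_mem _ fun i _ => Submodule.subset_span ⟨i, rfl⟩

variable {F}

lemma vertex_mul_arr {x : PathAlgebra F Q} (hx : x ∈ vertexSpace F Q) (a : Quiver.Total Q) :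
    x * arr F a = char F a.right x • arr F a := by
  induction hx using Submodule.span_induction with
  | mem x hx =>
    obtain ⟨i, rfl⟩ := hx
    rw [char_e]
    split_ifs with h
    · rw [h, e_mul_arr, one_smul]
    · rw [← e_mul_arr, ← mul_assoc, e_mul_ne F h, zero_mul, zero_smul]
  | zero => simp
  | add x y _ _ hx hy => rw [add_mul, hx, hy, map_add, add_smul]
  | smul c x _ hx => rw [smul_mul_assoc, hx, map_smul, smul_assoc]

lemma arr_mul_vertex {x : PathAlgebra F Q} (hx : x ∈ vertexSpace F Q) (a : Quiver.Total Q) :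
    arr F a * x = char F a.left x • arr F a := by
  induction hx using Submodule.span_induction with
  | mem x hx =>
    obtain ⟨i, rfl⟩ := hx
    rw [char_e]
    split_ifs with h
    · rw [h, arr_mul_e, one_smul]
    · rw [← arr_mul_e, mul_assoc, e_mul_ne F (Ne.symm h), mul_zero, zero_smul]
  | zero => simp
  | add x y _ _ hx hy => rw [mul_add, hx, hy, map_add, add_smul]
  | smul c x _ hx => rw [mul_smul_comm, hx, map_smul, smul_assoc]

lemma derivL_vertex {x : PathAlgebra F Q} (hx : x ∈ vertexSpace F Q) (a : Quiver.Total Q) :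
    derivL F a x = 0 := by
  have : vertexSpace F Q ≤ LinearMap.ker (derivL F a) := by
    refine Submodule.span_le.2 ?_
    rintro _ ⟨i, rfl⟩
    exact derivL_e F a i
  exact this hx

lemma derivR_vertex {x : PathAlgebra F Q} (hx : x ∈ vertexSpace F Q) (a : Quiver.Total Q) :
    derivR F a x = 0 := by
  have : vertexSpace F Q ≤ LinearMap.ker (derivR F a) := by
    refine Submodule.span_le.2 ?_
    rintro _ ⟨i, rfl⟩
    exact derivR_e F a i
  exact this hx

lemma derivL_vertex_mul_mul {x y : PathAlgebra F Q} (hx : x ∈ vertexSpace F Q)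
    (hy : y ∈ vertexSpace F Q) (a : Quiver.Total Q) (w : PathAlgebra F Q) :
    derivL F a (x * w * y) = char F a.right x • (derivL F a w * y) := by
  rw [mul_assoc, derivL_mul, derivL_mul, derivL_vertex hx, derivL_vertex hy]; simp

lemma derivR_vertex_mul_mul {x y : PathAlgebra F Q} (hx : x ∈ vertexSpace F Q)
    (hy : y ∈ vertexSpace F Q) (a : Quiver.Total Q) (w : PathAlgebra F Q) :
    derivR F a (x * w * y) = char F a.left y • (x * derivR F a w) := by
  rw [derivR_mul, derivR_mul, derivR_vertex hx, derivR_vertex hy]; simp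

open Classical in
lemma derivL_arr_mul (a b : Quiver.Total Q) (x : PathAlgebra F Q) :
    derivL F a (arr F b * x) = if a = b then e F b.left * x else 0 := by
  rw [derivL_mul, derivL_arr, char_arr]
  split_ifs <;> simp

open Classical in
lemma derivR_mul_arr (a b : Quiver.Total Q) (x : PathAlgebra F Q) :
    derivR F a (x * arr F b) = if a = b then x * e F b.right else 0 := by
  rw [derivR_mul, derivR_arr, char_arr]
  split_ifs <;> simp

/-- Stability under the left action of the vertices. -/
def LeftStable (S : Submodule F (PathAlgebra F Q)) : Prop := ∀ i, ∀ x ∈ S, e F i * x ∈ S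

/-- Stability under the right action of the vertices. -/
def RightStable (S : Submodule F (PathAlgebra F Q)) : Prop := ∀ i, ∀ x ∈ S, x * e F i ∈ S

lemma LeftStable.mul {S : Submodule F (PathAlgebra F Q)} (h : LeftStable S)
    (U : Submodule F (PathAlgebra F Q)) : LeftStable (S * U) := by
  intro i x hx
  induction hx using Submodule.mul_induction_on' with
  | mem_mul_mem m hm n hn => rw [← mul_assoc]; exact Submodule.mul_mem_mul (h i m hm) hn
  | add x _ y _ hx hy => rw [mul_add]; exact add_mem hx hy

lemma RightStable.mul {S : Submodule F (PathAlgebra F Q)} (h : RightStable S)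
    (U : Submodule F (PathAlgebra F Q)) : RightStable (U * S) := by
  intro i x hx
  induction hx using Submodule.mul_induction_on' with
  | mem_mul_mem m hm n hn => rw [mul_assoc]; exact Submodule.mul_mem_mul hm (h i n hn)
  | add x _ y _ hx hy => rw [add_mul]; exact add_mem hx hy

lemma leftStable_arrowSpace : LeftStable (arrowSpace F Q) := by
  intro i x hx
  induction hx using Submodule.span_induction with
  | mem x hx =>
    obtain ⟨a, rfl⟩ := hx
    rw [vertex_mul_arr (Submodule.subset_span ⟨i, rfl⟩)]
    exact Submodule.smul_mem _ _ (Submodule.subset_span ⟨a, rfl⟩)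
  | zero => simp
  | add x y _ _ hx hy => rw [mul_add]; exact add_mem hx hy
  | smul c x _ hx => rw [mul_smul_comm]; exact Submodule.smul_mem _ _ hx

lemma rightStable_arrowSpace : RightStable (arrowSpace F Q) := by
  intro i x hx
  induction hx using Submodule.span_induction with
  | mem x hx =>
    obtain ⟨a, rfl⟩ := hx
    rw [arr_mul_vertex (Submodule.subset_span ⟨i, rfl⟩)]
    exact Submodule.smul_mem _ _ (Submodule.subset_span ⟨a, rfl⟩)
  | zero => simp
  | add x y _ _ hx hy => rw [add_mul]; exact add_mem hx hy
  | smul c x _ hx => rw [smul_mul_assoc]; exact Submodule.smul_mem _ _ hx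

lemma LeftStable.vertex_mul {S : Submodule F (PathAlgebra F Q)} (h : LeftStable S)
    {x w : PathAlgebra F Q} (hx : x ∈ vertexSpace F Q) (hw : w ∈ S) : x * w ∈ S := by
  induction hx using Submodule.span_induction with
  | mem x hx => obtain ⟨i, rfl⟩ := hx; exact h i w hw
  | zero => simp
  | add x y _ _ hx hy => rw [add_mul]; exact add_mem hx hy
  | smul c x _ hx => rw [smul_mul_assoc]; exact Submodule.smul_mem _ _ hx

lemma RightStable.mul_vertex {S : Submodule F (PathAlgebra F Q)} (h : RightStable S)
    {x w : PathAlgebra F Q} (hx : x ∈ vertexSpace F Q) (hw : w ∈ S) : w * x ∈ S := by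
  induction hx using Submodule.span_induction with
  | mem x hx => obtain ⟨i, rfl⟩ := hx; exact h i w hw
  | zero => simp
  | add x y _ _ hx hy => rw [mul_add]; exact add_mem hx hy
  | smul c x _ hx => rw [mul_smul_comm]; exact Submodule.smul_mem _ _ hx

lemma derivL_mem {S : Submodule F (PathAlgebra F Q)} (h : LeftStable S) (a : Quiver.Total Q)
    {x : PathAlgebra F Q} (hx : x ∈ arrowSpace F Q * S) : derivL F a x ∈ S := by
  induction hx using Submodule.mul_induction_on' with
  | mem_mul_mem m hm n hn =>
    induction hm using Submodule.span_induction with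
    | mem x hx =>
      obtain ⟨b, rfl⟩ := hx
      rw [derivL_arr_mul]
      split_ifs
      · exact h _ _ hn
      · exact zero_mem _
    | zero => simp
    | add x y _ _ hx hy => rw [add_mul, map_add]; exact add_mem hx hy
    | smul c x _ hx => rw [smul_mul_assoc, map_smul]; exact Submodule.smul_mem _ _ hx
  | add x _ y _ hx hy => rw [map_add]; exact add_mem hx hy

lemma derivR_mem {S : Submodule F (PathAlgebra F Q)} (h : RightStable S) (a : Quiver.Total Q)
    {x : PathAlgebra F Q} (hx : x ∈ S * arrowSpace F Q) : derivR F a x ∈ S := by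
  induction hx using Submodule.mul_induction_on' with
  | mem_mul_mem m hm n hn =>
    induction hn using Submodule.span_induction with
    | mem x hx =>
      obtain ⟨b, rfl⟩ := hx
      rw [derivR_mul_arr]
      split_ifs
      · exact h _ _ hm
      · exact zero_mem _
    | zero => simp
    | add x y _ _ hx hy => rw [mul_add, map_add]; exact add_mem hx hy
    | smul c x _ hx => rw [mul_smul_comm, map_smul]; exact Submodule.smul_mem _ _ hx
  | add x _ y _ hx hy => rw [map_add]; exact add_mem hx hy

/-- The left and right derivatives commute. -/
lemma derivL_derivR_comm (a b : Quiver.Total Q) {x : PathAlgebra F Q}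
    (hx : x ∈ arrowSpace F Q * (⊤ : Submodule F (PathAlgebra F Q))) :
    derivL F a (derivR F b x) = derivR F b (derivL F a x) := by
  induction hx using Submodule.mul_induction_on' with
  | mem_mul_mem m hm n hn =>
    induction hm using Submodule.span_induction with
    | mem x hx =>
      obtain ⟨c, rfl⟩ := hx
      rw [derivL_arr_mul, derivR_mul, derivR_arr, map_add, derivL_arr_mul, map_smul]
      split_ifs <;> simp [derivL_e, derivR_mul, derivR_e]
    | zero => simp
    | add x y _ _ hx hy => simp only [add_mul, map_add, hx, hy]
    | smul c x _ hx => simp only [smul_mul_assoc, map_smul, hx]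
  | add x _ y _ hx hy => simp only [map_add, hx, hy]

end PathAlgebra

end PathAlgebra

/-! ## Enveloping algebras -/

/-- The enveloping algebra `A^e = A ⊗ A^op`; `A`-bimodules (on which `F` acts symmetrically) are
the left `A^e`-modules. -/
def Env (F : Type u) [Field F] (A : Type u) [Ring A] [Algebra F A] : Type u := A ⊗[F] Aᵐᵒᵖ

open MulOpposite

namespace Env

variable (F : Type u) [Field F] {A : Type u} [Ring A] [Algebra F A]

instance : Ring (Env F A) := inferInstanceAs (Ring (A ⊗[F] Aᵐᵒᵖ))
instance : Algebra F (Env F A) := inferInstanceAs (Algebra F (A ⊗[F] Aᵐᵒᵖ))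

/-- The element `a ⊗ b` of `A^e`, with `b` in `A^op`. -/
def of (a b : A) : Env F A := a ⊗ₜ[F] op b

lemma of_mul (a b a' b' : A) : of F a b * of F a' b' = of F (a * a') (b' * b) :=
  Algebra.TensorProduct.tmul_mul_tmul a a' (op b) (op b')

lemma of_one : of F (1 : A) 1 = 1 := rfl

lemma smul_of_left (c : F) (a b : A) : of F (c • a) b = c • of F a b :=
  (TensorProduct.smul_tmul' c a (op b)).symm

lemma smul_of_right (c : F) (a b : A) : of F a (c • b) = c • of F a b :=
  (TensorProduct.tmul_smul c a (op b))

lemma add_of_left (a a' b : A) : of F (a + a') b = of F a b + of F a' b :=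
  TensorProduct.add_tmul a a' (op b)

lemma add_of_right (a b b' : A) : of F a (b + b') = of F a b + of F a b' :=
  TensorProduct.tmul_add a (op b) (op b')

lemma zero_of_left (b : A) : of F 0 b = 0 := TensorProduct.zero_tmul _ _

lemma zero_of_right (a : A) : of F a 0 = 0 := TensorProduct.tmul_zero _ _

end Env

/-! ## Quadratic algebras over a quiver -/

open PathAlgebra

/-- A sub-`k`-bimodule `R` of `V ⊗_k V`, seen inside the path algebra. -/
structure QuadraticRelations (F : Type u) [Field F] (Q : Type u) [Quiver.{u} Q] [Fintype Q] where
  /-- the space of relations -/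
  R : Submodule F (PathAlgebra F Q)
  le_sq : R ≤ arrowSpace F Q * arrowSpace F Q
  e_mul_mem : ∀ (i : Q), ∀ r ∈ R, e F i * r ∈ R
  mul_e_mem : ∀ (i : Q), ∀ r ∈ R, r * e F i ∈ R

namespace QuadraticRelations

variable {F : Type u} [Field F] {Q : Type u} [Quiver.{u} Q] [Fintype Q]
variable (R : QuadraticRelations F Q)

/-- The quadratic algebra `A = T_k(V)/(R)`. -/
def Alg : Type u := RingQuot fun x y : PathAlgebra F Q => x ∈ R.R ∧ y = 0

instance : Ring R.Alg :=
  inferInstanceAs (Ring (RingQuot fun x y : PathAlgebra F Q => x ∈ R.R ∧ y = 0))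
instance : Algebra F R.Alg :=
  inferInstanceAs (Algebra F (RingQuot fun x y : PathAlgebra F Q => x ∈ R.R ∧ y = 0))

/-- The projection from the path algebra to `A`. -/
def proj : PathAlgebra F Q →ₐ[F] R.Alg := RingQuot.mkAlgHom F _

lemma proj_eq_zero {x : PathAlgebra F Q} (hx : x ∈ R.R) : R.proj x = 0 := by
  have := RingQuot.mkAlgHom_rel F (s := fun x y : PathAlgebra F Q => x ∈ R.R ∧ y = 0)
    (x := x) (y := 0) ⟨hx, rfl⟩
  rwa [map_zero] at this

/-- The spaces `W_p`: `W_0 = k`, `W_1 = V`, and `W_p` is the intersection of the spaces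
`V^{⊗ i} ⊗_k R ⊗_k V^{⊗ j}` with `i + 2 + j = p`. The zeroth power `V ^ 0` is the line of
constants, which gives the same products as `k` because `R` is a `k`-bimodule. -/
def W : ℕ → Submodule F (PathAlgebra F Q)
  | 0 => vertexSpace F Q
  | 1 => arrowSpace F Q
  | p + 2 => ⨅ (i : ℕ) (j : ℕ) (_ : i + j = p), arrowSpace F Q ^ i * R.R * arrowSpace F Q ^ j

lemma mem_W_add_two {p : ℕ} {x : PathAlgebra F Q} : x ∈ R.W (p + 2) ↔
    ∀ i j, i + j = p → x ∈ arrowSpace F Q ^ i * R.R * arrowSpace F Q ^ j := by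
  simp [W, Submodule.mem_iInf]

lemma leftStable_aux (i j : ℕ) : LeftStable (arrowSpace F Q ^ i * R.R * arrowSpace F Q ^ j) := by
  refine LeftStable.mul ?_ _
  cases i with
  | zero => rw [pow_zero, one_mul]; exact R.e_mul_mem
  | succ i => rw [pow_succ', mul_assoc]; exact leftStable_arrowSpace.mul _

lemma rightStable_aux (i j : ℕ) : RightStable (arrowSpace F Q ^ i * R.R * arrowSpace F Q ^ j) := by
  rw [mul_assoc]
  refine RightStable.mul ?_ _
  cases j with
  | zero => rw [pow_zero, mul_one]; exact R.mul_e_mem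
  | succ i => rw [pow_succ, ← mul_assoc]; exact rightStable_arrowSpace.mul _

lemma leftStable_W (p : ℕ) : LeftStable (R.W p) := by
  match p with
  | 0 =>
    intro i x hx
    change x ∈ vertexSpace F Q at hx
    change e F i * x ∈ vertexSpace F Q
    induction hx using Submodule.span_induction with
    | mem x hx =>
      obtain ⟨j, rfl⟩ := hx
      by_cases h : i = j
      · subst h; rw [e_mul_self]; exact Submodule.subset_span ⟨i, rfl⟩
      · rw [e_mul_ne F h]; exact zero_mem _
    | zero => simp
    | add x y _ _ hx hy => rw [mul_add]; exact add_mem hx hy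
    | smul c x _ hx => rw [mul_smul_comm]; exact Submodule.smul_mem _ _ hx
  | 1 => exact leftStable_arrowSpace
  | p + 2 =>
    intro k x hx
    rw [mem_W_add_two] at hx ⊢
    exact fun i j h => R.leftStable_aux i j k x (hx i j h)

lemma rightStable_W (p : ℕ) : RightStable (R.W p) := by
  match p with
  | 0 =>
    intro i x hx
    change x ∈ vertexSpace F Q at hx
    change x * e F i ∈ vertexSpace F Q
    induction hx using Submodule.span_induction with
    | mem x hx =>
      obtain ⟨j, rfl⟩ := hx
      by_cases h : j = i
      · subst h; rw [e_mul_self]; exact Submodule.subset_span ⟨j, rfl⟩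
      · rw [e_mul_ne F h]; exact zero_mem _
    | zero => simp
    | add x y _ _ hx hy => rw [add_mul]; exact add_mem hx hy
    | smul c x _ hx => rw [smul_mul_assoc]; exact Submodule.smul_mem _ _ hx
  | 1 => exact rightStable_arrowSpace
  | p + 2 =>
    intro k x hx
    rw [mem_W_add_two] at hx ⊢
    exact fun i j h => R.rightStable_aux i j k x (hx i j h)

lemma derivL_mem_W (a : Quiver.Total Q) (p : ℕ) {w : PathAlgebra F Q} (hw : w ∈ R.W (p + 1)) :
    derivL F a w ∈ R.W p := by
  match p with
  | 0 =>
    refine derivL_mem (R.leftStable_W 0) a ?_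
    change w ∈ arrowSpace F Q * vertexSpace F Q
    rw [← mul_one w]
    exact Submodule.mul_mem_mul hw (one_mem_vertexSpace F)
  | 1 =>
    refine derivL_mem (R.leftStable_W 1) a (R.le_sq ?_)
    simpa using R.mem_W_add_two.1 hw 0 0 rfl
  | p + 2 =>
    rw [mem_W_add_two]
    intro i j h
    refine derivL_mem (R.leftStable_aux i j) a ?_
    rw [← mul_assoc, ← mul_assoc, ← pow_succ']
    exact R.mem_W_add_two.1 hw (i + 1) j (by omega)

lemma derivR_mem_W (a : Quiver.Total Q) (p : ℕ) {w : PathAlgebra F Q} (hw : w ∈ R.W (p + 1)) :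
    derivR F a w ∈ R.W p := by
  match p with
  | 0 =>
    refine derivR_mem (R.rightStable_W 0) a ?_
    change w ∈ vertexSpace F Q * arrowSpace F Q
    rw [← one_mul w]
    exact Submodule.mul_mem_mul (one_mem_vertexSpace F) hw
  | 1 =>
    refine derivR_mem (R.rightStable_W 1) a (R.le_sq ?_)
    simpa using R.mem_W_add_two.1 hw 0 0 rfl
  | p + 2 =>
    rw [mem_W_add_two]
    intro i j h
    refine derivR_mem (R.rightStable_aux i j) a ?_
    rw [mul_assoc, ← pow_succ]
    exact R.mem_W_add_two.1 hw i (j + 1) (by omega)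

/-- `w ↦ ∂_α w` as a map `W_{p+1} → W_p`. -/
def leftCut (p : ℕ) (a : Quiver.Total Q) : R.W (p + 1) →ₗ[F] R.W p :=
  (derivL F a).restrict fun _ => R.derivL_mem_W a p

/-- The right derivative as a map `W_{p+1} → W_p`. -/
def rightCut (p : ℕ) (a : Quiver.Total Q) : R.W (p + 1) →ₗ[F] R.W p :=
  (derivR F a).restrict fun _ => R.derivR_mem_W a p

/-! ### The bimodule Koszul complex -/

/-- The submodule of the free `A`-bimodule `A ⊗ W_p ⊗ A`, written as `A^e ⊗ W_p`, generated by the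
elements `x ⊗ w ⊗ y - 1 ⊗ x w y ⊗ 1` with `x`, `y` in `k` and `w` in `W_p`. -/
def balance (p : ℕ) : Submodule (Env F R.Alg) (Env F R.Alg ⊗[F] R.W p) :=
  Submodule.span _ {z | ∃ x ∈ vertexSpace F Q, ∃ y ∈ vertexSpace F Q, ∃ w w' : R.W p,
    (w' : PathAlgebra F Q) = x * w * y ∧
      z = Env.of F (R.proj x) (R.proj y) ⊗ₜ w - (1 : Env F R.Alg) ⊗ₜ w'}

/-- The `A`-bimodule `A ⊗_k W_p ⊗_k A`. -/
abbrev Term (p : ℕ) : Type u := (Env F R.Alg ⊗[F] R.W p) ⧸ R.balance p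

/-- The map `w ↦ 1 ⊗ w ⊗ 1`. -/
def incl (p : ℕ) : R.W p →ₗ[F] R.Term p :=
  ((R.balance p).mkQ.restrictScalars F) ∘ₗ TensorProduct.mk F (Env F R.Alg) (R.W p) 1

lemma incl_balance (p : ℕ) {x y : PathAlgebra F Q} (hx : x ∈ vertexSpace F Q)
    (hy : y ∈ vertexSpace F Q) {w w' : R.W p} (h : (w' : PathAlgebra F Q) = x * w * y) :
    Env.of F (R.proj x) (R.proj y) • R.incl p w = R.incl p w' := by
  have : (R.balance p).mkQ (Env.of F (R.proj x) (R.proj y) ⊗ₜ w - (1 : Env F R.Alg) ⊗ₜ w') = 0 := by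
    rw [Submodule.mkQ_apply, Submodule.Quotient.mk_eq_zero]
    exact Submodule.subset_span ⟨x, hx, y, hy, w, w', h, rfl⟩
  rw [map_sub, sub_eq_zero] at this
  rw [incl, LinearMap.comp_apply, LinearMap.comp_apply, LinearMap.restrictScalars_apply,
    LinearMap.restrictScalars_apply, ← map_smul, TensorProduct.mk_apply, TensorProduct.mk_apply,
    TensorProduct.smul_tmul', smul_eq_mul, mul_one, this]

variable {R} in
lemma term_hom_ext {p : ℕ} {M : Type u} [AddCommGroup M] [Module (Env F R.Alg) M]
    {f g : R.Term p →ₗ[Env F R.Alg] M} (h : ∀ w, f (R.incl p w) = g (R.incl p w)) : f = g := by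
  refine Submodule.linearMap_qext _ (LinearMap.ext fun z => ?_)
  induction z using TensorProduct.induction_on with
  | zero => simp
  | add x y hx hy => rw [map_add, map_add, hx, hy]
  | tmul x w =>
    have : x ⊗ₜ[F] w = x • ((1 : Env F R.Alg) ⊗ₜ[F] w) := by
      rw [TensorProduct.smul_tmul', smul_eq_mul, mul_one]
    rw [this, map_smul, map_smul]
    exact congrArg (x • ·) (h w)

lemma smul_incl (p : ℕ) (x : Env F R.Alg) (w : R.W p) :
    x • R.incl p w = (R.balance p).mkQ (x ⊗ₜ w) := by
  change x • (R.balance p).mkQ (1 ⊗ₜ w) = _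
  rw [← map_smul, TensorProduct.smul_tmul', smul_eq_mul, mul_one]

lemma sum_smul_incl_eq_zero (p : ℕ) {ι : Type u} (s : Finset ι) (x : ι → Env F R.Alg)
    (w : ι → R.W p) (h : ∑ i ∈ s, x i ⊗ₜ[F] (w i : PathAlgebra F Q) = 0) :
    ∑ i ∈ s, x i • R.incl p (w i) = 0 := by
  simp only [smul_incl]
  rw [← map_sum]
  have : ∑ i ∈ s, x i ⊗ₜ[F] w i = 0 := by
    refine Module.Flat.lTensor_preserves_injective_linearMap (M := Env F R.Alg) (R.W p).subtype
      Subtype.val_injective ?_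
    simpa using h
  rw [this, map_zero]

variable [Fintype (Quiver.Total Q)]

/-- The restriction of the Koszul differential to `W_{p+1}`:
`x_1 ⋯ x_{p+1} ↦ x_1 ⊗ x_2 ⋯ x_{p+1} ⊗ 1 + (-1)^{p+1} 1 ⊗ x_1 ⋯ x_p ⊗ x_{p+1}`. -/
def dGen (p : ℕ) : R.W (p + 1) →ₗ[F] R.Term p :=
  ∑ a : Quiver.Total Q,
    (Algebra.lsmul F F (R.Term p) (Env.of F (R.proj (arr F a)) 1) ∘ₗ R.incl p ∘ₗ
        R.leftCut p a +
      (-1 : F) ^ (p + 1) • (Algebra.lsmul F F (R.Term p)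
        (Env.of F 1 (R.proj (arr F a))) ∘ₗ R.incl p ∘ₗ R.rightCut p a))

lemma dGen_apply (p : ℕ) (w : R.W (p + 1)) : R.dGen p w =
    ∑ a : Quiver.Total Q, ((Env.of F (R.proj (arr F a)) 1) • R.incl p (R.leftCut p a w) +
      (-1 : F) ^ (p + 1) • (Env.of F 1 (R.proj (arr F a))) •
        R.incl p (R.rightCut p a w)) := by
  simp [dGen]

/-- The differential on the free bimodule `A ⊗ W_{p+1} ⊗ A`. -/
def dFree (p : ℕ) : Env F R.Alg ⊗[F] R.W (p + 1) →ₗ[Env F R.Alg] R.Term p :=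
  TensorProduct.AlgebraTensorModule.lift
    (LinearMap.toSpanSingleton (Env F R.Alg) (R.W (p + 1) →ₗ[F] R.Term p) (R.dGen p))

lemma dFree_tmul (p : ℕ) (x : Env F R.Alg) (w : R.W (p + 1)) :
    R.dFree p (x ⊗ₜ w) = x • R.dGen p w := by
  simp [dFree]

lemma balance_le_ker (p : ℕ) : R.balance (p + 1) ≤ LinearMap.ker (R.dFree p) := by
  refine Submodule.span_le.2 ?_
  rintro _ ⟨x, hx, y, hy, w, w', h, rfl⟩
  rw [SetLike.mem_coe, LinearMap.mem_ker, map_sub, sub_eq_zero, dFree_tmul, dFree_tmul, one_smul,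
    dGen_apply, dGen_apply, Finset.smul_sum]
  refine Finset.sum_congr rfl fun a _ => ?_
  have h1 : (1 : PathAlgebra F Q) ∈ vertexSpace F Q := one_mem_vertexSpace F
  rw [smul_add, smul_comm _ ((-1 : F) ^ (p + 1)), smul_smul, smul_smul]
  congr 1
  · have e1 : Env.of F (R.proj x) (R.proj y) * Env.of F (R.proj (arr F a)) 1 =
        Env.of F (R.proj (arr F a)) 1 * (char F a.right x • Env.of F (R.proj 1) (R.proj y)) := by
      rw [mul_smul_comm, Env.of_mul, Env.of_mul, ← map_mul, vertex_mul_arr hx, map_smul,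
        Env.smul_of_left]
      simp
    let v : R.W p := ⟨derivL F a w * y,
      (R.rightStable_W p).mul_vertex hy (R.derivL_mem_W a p w.2)⟩
    have e2 : R.leftCut p a w' = char F a.right x • v := by
      ext
      simp only [leftCut, LinearMap.coe_restrict_apply, h, v]
      exact derivL_vertex_mul_mul hx hy a w
    rw [e1, mul_smul, smul_assoc, R.incl_balance p h1 hy (w' := v) (by simp [v, leftCut]), e2,
      map_smul]
  · congr 1
    have e1 : Env.of F (R.proj x) (R.proj y) * Env.of F 1 (R.proj (arr F a)) =
        Env.of F 1 (R.proj (arr F a)) * (char F a.left y • Env.of F (R.proj x) (R.proj 1)) := by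
      rw [mul_smul_comm, Env.of_mul, Env.of_mul, ← map_mul, arr_mul_vertex hy, map_smul,
        Env.smul_of_right]
      simp
    let v : R.W p := ⟨x * derivR F a w,
      (R.leftStable_W p).vertex_mul hx (R.derivR_mem_W a p w.2)⟩
    have e2 : R.rightCut p a w' = char F a.left y • v := by
      ext
      simp only [rightCut, LinearMap.coe_restrict_apply, h, v]
      exact derivR_vertex_mul_mul hx hy a w
    rw [e1, mul_smul, smul_assoc, R.incl_balance p hx h1 (w' := v) (by simp [v, rightCut]), e2,
      map_smul]

/-- The Koszul differential `A ⊗_k W_{p+1} ⊗_k A → A ⊗_k W_p ⊗_k A`. -/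
def d (p : ℕ) : R.Term (p + 1) →ₗ[Env F R.Alg] R.Term p :=
  (R.balance (p + 1)).liftQ (R.dFree p) (R.balance_le_ker p)

lemma d_incl (p : ℕ) (w : R.W (p + 1)) : R.d p (R.incl (p + 1) w) = R.dGen p w := by
  change R.dFree p (1 ⊗ₜ w) = _
  rw [dFree_tmul, one_smul]

lemma sum_cut_left (v : PathAlgebra F Q) {u : PathAlgebra F Q}
    (hu : u ∈ arrowSpace F Q * arrowSpace F Q) :
    ∑ a : Quiver.Total Q, ∑ b : Quiver.Total Q,
      Env.of F (R.proj (arr F a * arr F b)) 1 ⊗ₜ[F] derivL F b (derivL F a (u * v)) =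
    ∑ j : Q, Env.of F (R.proj (u * e F j)) 1 ⊗ₜ[F] (e F j * v) := by
  rw [arrowSpace, Submodule.span_mul_span] at hu
  induction hu using Submodule.span_induction with
  | mem u hu =>
    obtain ⟨_, ⟨c, rfl⟩, _, ⟨d, rfl⟩, rfl⟩ := hu
    classical
    have key : ∀ a b : Quiver.Total Q,
        Env.of F (R.proj (arr F a * arr F b)) 1 ⊗ₜ[F]
          derivL F b (derivL F a (arr F c * arr F d * v)) =
        if c = a then if d = b then
          Env.of F (R.proj (arr F c * arr F d)) 1 ⊗ₜ[F] (e F d.left * v) else 0 else 0 := by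
      intro a b
      rw [mul_assoc, derivL_arr_mul]
      by_cases h : a = c
      · subst h
        rw [if_pos rfl, if_pos rfl, derivL_mul, derivL_e, zero_mul, zero_add, derivL_arr_mul,
          char_e]
        by_cases h' : b = d
        · subst h'
          rw [if_pos rfl, if_pos rfl]
          split_ifs with h1
          · rw [one_smul]
          · have : arr F a * arr F b = 0 := by
              rw [← arr_mul_e, ← e_mul_arr F b, mul_assoc, ← mul_assoc (e F a.left),
                e_mul_ne F h1, zero_mul, mul_zero]
            rw [this, map_zero, Env.zero_of_left, TensorProduct.zero_tmul,
              TensorProduct.zero_tmul]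
        · rw [if_neg h', if_neg (Ne.symm h'), smul_zero, TensorProduct.tmul_zero]
      · rw [if_neg h, if_neg (Ne.symm h), map_zero, TensorProduct.tmul_zero]
    simp only [key]
    rw [Finset.sum_comm]
    simp only [Finset.sum_ite_eq, Finset.mem_univ, if_true]
    rw [Finset.sum_eq_single d.left]
    · rw [mul_assoc, arr_mul_e]
    · intro j _ hj
      rw [mul_assoc, ← arr_mul_e F d, mul_assoc (arr F d), e_mul_ne F (Ne.symm hj), mul_zero, mul_zero,
        map_zero, Env.zero_of_left, TensorProduct.zero_tmul]
    · simp
  | zero => simp [Env.zero_of_left]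
  | add x y _ _ hx hy =>
    simp only [add_mul, map_add, TensorProduct.tmul_add, Finset.sum_add_distrib, hx, hy,
      Env.add_of_left, TensorProduct.add_tmul]
  | smul c x _ hx =>
    simp only [smul_mul_assoc, map_smul, TensorProduct.tmul_smul, ← Finset.smul_sum, hx,
      Env.smul_of_left, TensorProduct.smul_tmul]

lemma sum_cut_right (v : PathAlgebra F Q) {u : PathAlgebra F Q}
    (hu : u ∈ arrowSpace F Q * arrowSpace F Q) :
    ∑ a : Quiver.Total Q, ∑ b : Quiver.Total Q,
      Env.of F 1 (R.proj (arr F b * arr F a)) ⊗ₜ[F] derivR F b (derivR F a (v * u)) =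
    ∑ j : Q, Env.of F 1 (R.proj (e F j * u)) ⊗ₜ[F] (v * e F j) := by
  rw [arrowSpace, Submodule.span_mul_span] at hu
  induction hu using Submodule.span_induction with
  | mem u hu =>
    obtain ⟨_, ⟨c, rfl⟩, _, ⟨d, rfl⟩, rfl⟩ := hu
    classical
    have key : ∀ a b : Quiver.Total Q,
        Env.of F 1 (R.proj (arr F b * arr F a)) ⊗ₜ[F]
          derivR F b (derivR F a (v * (arr F c * arr F d))) =
        if d = a then if c = b then
          Env.of F 1 (R.proj (arr F c * arr F d)) ⊗ₜ[F] (v * e F c.right) else 0 else 0 := by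
      intro a b
      rw [← mul_assoc, derivR_mul_arr]
      by_cases h : a = d
      · subst h
        rw [if_pos rfl, if_pos rfl, derivR_mul, derivR_e, mul_zero, zero_add, derivR_mul_arr,
          char_e]
        by_cases h' : b = c
        · subst h'
          rw [if_pos rfl, if_pos rfl]
          split_ifs with h1
          · rw [one_smul]
          · have : arr F b * arr F a = 0 := by
              rw [← arr_mul_e, ← e_mul_arr F a, mul_assoc, ← mul_assoc (e F b.left),
                e_mul_ne F (Ne.symm h1), zero_mul, mul_zero]
            rw [this, map_zero, Env.zero_of_right, TensorProduct.zero_tmul,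
              TensorProduct.zero_tmul]
        · rw [if_neg h', if_neg (Ne.symm h'), smul_zero, TensorProduct.tmul_zero]
      · rw [if_neg h, if_neg (Ne.symm h), map_zero, TensorProduct.tmul_zero]
    simp only [key]
    rw [Finset.sum_comm]
    simp only [Finset.sum_ite_eq, Finset.mem_univ, if_true]
    rw [Finset.sum_eq_single c.right]
    · rw [← mul_assoc, e_mul_arr]
    · intro j _ hj
      rw [← mul_assoc, ← e_mul_arr F c, ← mul_assoc (e F j), e_mul_ne F hj, zero_mul, zero_mul,
        map_zero, Env.zero_of_right, TensorProduct.zero_tmul]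
    · simp
  | zero => simp [Env.zero_of_right]
  | add x y _ _ hx hy =>
    simp only [mul_add, map_add, TensorProduct.tmul_add, Finset.sum_add_distrib, hx, hy,
      Env.add_of_right, TensorProduct.add_tmul]
  | smul c x _ hx =>
    simp only [mul_smul_comm, map_smul, TensorProduct.tmul_smul, ← Finset.smul_sum, hx,
      Env.smul_of_right, TensorProduct.smul_tmul]

lemma sum_cut_left_eq_zero {w : PathAlgebra F Q}
    (hw : w ∈ R.R * (⊤ : Submodule F (PathAlgebra F Q))) :
    ∑ a : Quiver.Total Q, ∑ b : Quiver.Total Q,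
      Env.of F (R.proj (arr F a * arr F b)) 1 ⊗ₜ[F] derivL F b (derivL F a w) = 0 := by
  induction hw using Submodule.mul_induction_on' with
  | mem_mul_mem u hu v hv =>
    rw [R.sum_cut_left v (R.le_sq hu)]
    refine Finset.sum_eq_zero fun j _ => ?_
    rw [R.proj_eq_zero (R.mul_e_mem j u hu), Env.zero_of_left, TensorProduct.zero_tmul]
  | add x _ y _ hx hy =>
    simp only [map_add, TensorProduct.tmul_add, Finset.sum_add_distrib, hx, hy, add_zero]

lemma sum_cut_right_eq_zero {w : PathAlgebra F Q}
    (hw : w ∈ (⊤ : Submodule F (PathAlgebra F Q)) * R.R) :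
    ∑ a : Quiver.Total Q, ∑ b : Quiver.Total Q,
      Env.of F 1 (R.proj (arr F b * arr F a)) ⊗ₜ[F] derivR F b (derivR F a w) = 0 := by
  induction hw using Submodule.mul_induction_on' with
  | mem_mul_mem v hv u hu =>
    rw [R.sum_cut_right v (R.le_sq hu)]
    refine Finset.sum_eq_zero fun j _ => ?_
    rw [R.proj_eq_zero (R.e_mul_mem j u hu), Env.zero_of_right, TensorProduct.zero_tmul]
  | add x _ y _ hx hy =>
    simp only [map_add, TensorProduct.tmul_add, Finset.sum_add_distrib, hx, hy, add_zero]

lemma d_comp_d (p : ℕ) : R.d p ∘ₗ R.d (p + 1) = 0 := by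
  refine term_hom_ext fun w => ?_
  have hw := R.mem_W_add_two.1 w.2
  have hl : (w : PathAlgebra F Q) ∈ R.R * (⊤ : Submodule F (PathAlgebra F Q)) := by
    have := hw 0 p (by omega)
    rw [pow_zero, one_mul] at this
    exact (mul_le_mul' le_rfl le_top : _ ≤ R.R * (⊤ : Submodule F (PathAlgebra F Q))) this
  have hr : (w : PathAlgebra F Q) ∈ (⊤ : Submodule F (PathAlgebra F Q)) * R.R := by
    have := hw p 0 (by omega)
    rw [pow_zero, mul_one] at this
    exact (mul_le_mul' le_top le_rfl : _ ≤ (⊤ : Submodule F (PathAlgebra F Q)) * R.R) this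
  have hv : (w : PathAlgebra F Q) ∈
      arrowSpace F Q * (⊤ : Submodule F (PathAlgebra F Q)) := by
    have := (mul_le_mul' R.le_sq le_rfl :
      R.R * (⊤ : Submodule F (PathAlgebra F Q)) ≤ _) hl
    rw [mul_assoc] at this
    exact (mul_le_mul' le_rfl le_top :
      _ ≤ arrowSpace F Q * (⊤ : Submodule F (PathAlgebra F Q))) this
  rw [LinearMap.comp_apply, d_incl, dGen_apply, map_sum, LinearMap.zero_apply]
  have hd : ∀ (c : F) (z : R.Term (p + 1)), R.d p (c • z) = c • R.d p z := fun c z => by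
    rw [← algebraMap_smul (Env F R.Alg) c z, map_smul, algebraMap_smul]
  simp only [map_add, map_smul, hd, d_incl, dGen_apply, smul_add, Finset.smul_sum,
    smul_comm (_ : Env F R.Alg) (_ : F), Finset.sum_add_distrib, smul_smul, Env.of_mul, mul_one,
    one_mul]
  have z1 : ∑ a : Quiver.Total Q, ∑ b : Quiver.Total Q,
      Env.of F (R.proj (arr F a) * R.proj (arr F b)) 1 •
        R.incl p (R.leftCut p b (R.leftCut (p + 1) a w)) = 0 := by
    rw [← Finset.sum_product']
    refine R.sum_smul_incl_eq_zero p _ _ _ ?_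
    rw [Finset.sum_product]
    simpa [leftCut] using R.sum_cut_left_eq_zero hl
  have z2 : ∑ a : Quiver.Total Q, ∑ b : Quiver.Total Q,
      Env.of F 1 (R.proj (arr F b) * R.proj (arr F a)) •
        R.incl p (R.rightCut p b (R.rightCut (p + 1) a w)) = 0 := by
    rw [← Finset.sum_product']
    refine R.sum_smul_incl_eq_zero p _ _ _ ?_
    rw [Finset.sum_product]
    simpa [rightCut] using R.sum_cut_right_eq_zero hr
  have z3 : ∀ a b, R.rightCut p b (R.leftCut (p + 1) a w) =
      R.leftCut p a (R.rightCut (p + 1) b w) := fun a b =>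
    Subtype.ext (derivL_derivR_comm a b hv).symm
  have z4 : ∑ a : Quiver.Total Q, ∑ b : Quiver.Total Q, (-1 : F) ^ (p + 1) •
      Env.of F (R.proj (arr F a)) (R.proj (arr F b)) •
        R.incl p (R.rightCut p b (R.leftCut (p + 1) a w)) =
      -∑ a : Quiver.Total Q, ∑ b : Quiver.Total Q, (-1 : F) ^ (p + 1 + 1) •
        Env.of F (R.proj (arr F b)) (R.proj (arr F a)) •
          R.incl p (R.leftCut p b (R.rightCut (p + 1) a w)) := by
    rw [Finset.sum_comm, ← Finset.sum_neg_distrib]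
    refine Finset.sum_congr rfl fun a _ => ?_
    rw [← Finset.sum_neg_distrib]
    refine Finset.sum_congr rfl fun b _ => ?_
    rw [z3, pow_succ (-1 : F) (p + 1), mul_neg, mul_one, neg_smul, neg_neg]
  simp only [← Finset.smul_sum] at z4 ⊢
  rw [z1, z2, z4]
  simp

end QuadraticRelations

/-! ## Derived duality and Calabi-Yau conditions -/

namespace Env

variable {F : Type u} [Field F] {A : Type u} [Ring A] [Algebra F A]

/-- `A` as an `A`-bimodule. -/
instance regular : Module (Env F A) A :=
  (TensorProduct.Algebra.module : Module (A ⊗[F] Aᵐᵒᵖ) A)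

lemma of_smul_regular (a b x : A) : of F a b • x = a * x * b := by
  let _ : Module (A ⊗[F] Aᵐᵒᵖ) A := TensorProduct.Algebra.module
  refine (TensorProduct.Algebra.smul_def a (op b) x).trans ?_
  rw [op_smul_eq_mul, smul_eq_mul, mul_assoc]

variable (F A) in
/-- The anti-automorphism `a ⊗ b ↦ b ⊗ a` of `A^e`, which turns right `A^e`-modules into
`A`-bimodules. -/
def swap : Env F A ≃ₐ[F] (Env F A)ᵐᵒᵖ :=
  ((Algebra.TensorProduct.comm F A Aᵐᵒᵖ).trans
    (Algebra.TensorProduct.congr AlgEquiv.refl (AlgEquiv.opOp F A))).trans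
      (Algebra.TensorProduct.opAlgEquiv F F A Aᵐᵒᵖ)

lemma swap_of (a b : A) : swap F A (of F a b) = op (of F b a) := rfl

variable (F A) in
/-- The bimodule `Hom_{A^e}(M, A^e)`: maps that are linear for the outer bimodule structure of
`A^e = A ⊗ A`, with the bimodule structure induced by the inner one. -/
def Dual (M : Type u) [AddCommGroup M] [Module (Env F A) M] : Type u := M →ₗ[Env F A] Env F A

variable (M N : Type u) [AddCommGroup M] [Module (Env F A) M] [AddCommGroup N] [Module (Env F A) N]

instance : AddCommGroup (Dual F A M) := inferInstanceAs (AddCommGroup (M →ₗ[Env F A] Env F A))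

instance : Module (Env F A) (Dual F A M) :=
  Module.compHom (M →ₗ[Env F A] Env F A) (swap F A : Env F A →+* (Env F A)ᵐᵒᵖ)

variable {M N}

/-- Evaluation of an element of the dual. -/
def Dual.eval (f : Dual F A M) (m : M) : Env F A := (show M →ₗ[Env F A] Env F A from f) m

lemma Dual.eval_smul (a b : A) (f : Dual F A M) (m : M) :
    (of F a b • f).eval m = f.eval m * of F b a := rfl

/-- Precomposition with a bimodule map. -/
def Dual.map (g : M →ₗ[Env F A] N) : Dual F A N →ₗ[Env F A] Dual F A M where
  toFun f := (show N →ₗ[Env F A] Env F A from f) ∘ₗ g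
  map_add' _ _ := rfl
  map_smul' _ _ := rfl

end Env

/-- The category of `A`-bimodules. -/
abbrev Bimod (F : Type u) [Field F] (A : Type u) [Ring A] [Algebra F A] : Type (u + 1) :=
  ModuleCat.{u} (Env F A)

section Derived

variable {F : Type u} [Field F] {A : Type u} [Ring A] [Algebra F A]

/-- The cochain complex `Hom_{A^e}(C, A^e)` of `A`-bimodules, with `Hom_{A^e}(C^{-n}, A^e)` in
degree `n` and precomposition with the differentials of `C` as differentials (the sign in front of
the differential that some conventions add does not change the complex up to isomorphism). -/
def dualComplex (C : CochainComplex (Bimod F A) ℤ) : CochainComplex (Bimod F A) ℤ where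
  X n := ModuleCat.of (Env F A) (Env.Dual F A (C.X (-n)))
  d i j := ModuleCat.ofHom (Env.Dual.map (C.d (-j) (-i)).hom)
  shape i j h := by
    have : C.d (-j) (-i) = 0 := C.shape _ _ (by simp at h ⊢; omega)
    rw [this]
    ext f
    exact LinearMap.comp_zero _
  d_comp_d' i j k _ _ := by
    ext f
    change LinearMap.comp (LinearMap.comp (show C.X (-i) →ₗ[Env F A] Env F A from f)
      (C.d (-j) (-i)).hom) (C.d (-k) (-j)).hom = 0
    rw [LinearMap.comp_assoc, ← ModuleCat.hom_comp, C.d_comp_d, ModuleCat.hom_zero,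
      LinearMap.comp_zero]

/-- `RHom_{A^e}(X, A^e) ≅ Y` in the derived category of `A`-bimodules. The derived functor is
computed by a K-projective resolution `P` of `X`. (For cohomologically bounded `X` and `Y`, an
isomorphism in the derived category is the same as one in the bounded derived category, which is
a full subcategory.) -/
def RHomEnvIso (X Y : CochainComplex (Bimod F A) ℤ) : Prop :=
  letI := HasDerivedCategory.standard (Bimod F A)
  ∃ (P : CochainComplex (Bimod F A) ℤ) (π : P ⟶ X), P.IsKProjective ∧ QuasiIso π ∧
    Nonempty (DerivedCategory.Q.obj (dualComplex P) ≅ DerivedCategory.Q.obj Y)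

variable (F A) in
/-- `A` as a complex of `A`-bimodules concentrated in degree `0`. -/
def regularComplex : CochainComplex (Bimod F A) ℤ :=
  (CochainComplex.singleFunctor (Bimod F A) 0).obj (ModuleCat.of (Env F A) A)

variable (F A) in
/-- `A` is homologically smooth: it has a bounded resolution by finitely generated projective
`A`-bimodules. -/
def IsHomologicallySmooth : Prop :=
  ∃ P : ProjectiveResolution (ModuleCat.of (Env F A) A),
    (∀ i, Module.Finite (Env F A) (P.complex.X i)) ∧
      ∃ N : ℕ, ∀ i, N < i → Limits.IsZero (P.complex.X i)

variable (F A) in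
/-- `A` is `n`-Calabi-Yau (in the sense of Ginzburg). -/
structure IsCalabiYau (n : ℕ) : Prop where
  smooth : IsHomologicallySmooth F A
  duality : RHomEnvIso (regularComplex F A) ((regularComplex F A)⟦(-n : ℤ)⟧)

end Derived

namespace QuadraticRelations

variable {F : Type u} [Field F] {Q : Type u} [Quiver.{u} Q] [Fintype Q]
  [Fintype (Quiver.Total Q)] (R : QuadraticRelations F Q)

/-- The bimodule Koszul complex `K(A)`, with `A ⊗_k W_p ⊗_k A` in homological degree `p`. -/
def koszulComplex : ChainComplex (Bimod F R.Alg) ℕ :=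
  ChainComplex.of (fun p => ModuleCat.of (Env F R.Alg) (R.Term p))
    (fun p => ModuleCat.ofHom (R.d p)) fun p => by
      rw [← ModuleCat.ofHom_comp, R.d_comp_d]; rfl

/-- `K(A)` as a cochain complex, with `A ⊗_k W_p ⊗_k A` in degree `-p`. -/
def koszulCochainComplex : CochainComplex (Bimod F R.Alg) ℤ :=
  R.koszulComplex.extend ComplexShape.embeddingDownNat

/-- `A` is Koszul: the homology of `K(A)` vanishes in each degree `> 1`. -/
def IsKoszul : Prop := ∀ p, 1 < p → R.koszulComplex.ExactAt p

/-- `A` is Koszul complex Calabi-Yau of dimension `n`. -/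
structure IsKcCalabiYau (n : ℕ) : Prop where
  /-- `K(A)` has length `n` -/
  term_ne_zero : ¬ Limits.IsZero (R.koszulComplex.X n)
  isZero_of_lt : ∀ p, n < p → Limits.IsZero (R.koszulComplex.X p)
  duality : RHomEnvIso R.koszulCochainComplex (R.koszulCochainComplex⟦(-n : ℤ)⟧)

end QuadraticRelations

end QuadraticQuiver

end

/-! Let `ε : K(A) → A` be the augmentation. Because `A` is quadratic, `ε` induces an isomorphism on
homology in degrees `0` and `1`, whatever happens higher up. The homology that remains is
`H_p(K(A))` with `p ≥ 2`; in cohomological grading the cone of `ε` is therefore concentrated in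
degrees `≤ -3`, and its shift by `-1` in degrees `≤ -2`. That shift has no nonzero map to `A^e`
placed in degree `-i` when `i ≤ 1`, so every class in `Ext^i(K(A), A^e)` with `i ≤ 1` factors
through `ε` and comes from `Ext^i(A, A^e)`.

The two dualities evaluate both sides: `Ext^i(A, A^e)` is `H^{i-n}(A)`, which is zero for `i ≠ n`,
while `Ext^i(K(A), A^e)` is `H_{n-i}(K(A))`. Hence `H_p(K(A)) = 0` whenever `p ≠ 0` and `n - p ≤ 1`.
If `n ≤ 3`, this covers every `p` with `2 ≤ p ≤ n`, and beyond `n` the complex is zero.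

Low-degree exactness is `exact_d_zero_aug` and `exact_d_one_d_zero`. The second rests on a universal
derivation: the classes of the arrows modulo the image of `d_1` define a derivation of `A`, since
the relations die there, and this derivation recovers the class of `t` from `d_0 t`. The passage to
the derived category is `hom_single_eq_zero_iff` (vanishing of Ext groups read off a K-projective
resolution), `hom_single_eq_zero_of_quasiIsoAt` (the cone argument) and `RHomEnvIso.exactAt_iff`
(duality as vanishing of Ext groups). `exactAt_of_calabiYau` combines them. -/

noncomputable section

namespace QuadraticQuiver

/-! ### Triangular operators that encode derivations into a bimodule -/

namespace Env

variable {F : Type u} [Field F] {A : Type u} [Ring A] [Algebra F A]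

lemma induct {P : Env F A → Prop} (h0 : P 0) (hof : ∀ a b, P (of F a b))
    (hadd : ∀ x y, P x → P y → P (x + y)) (z : Env F A) : P z := by
  change A ⊗[F] Aᵐᵒᵖ at z
  induction z using TensorProduct.induction_on with
  | zero => exact h0
  | tmul a b => exact hof a b.unop
  | add x y hx hy => exact hadd x y hx hy

instance : IsScalarTower F (Env F A) A where
  smul_assoc c z x := by
    induction z using induct with
    | h0 => simp
    | hof a b => rw [← smul_of_left, of_smul_regular, of_smul_regular]; simp
    | hadd y z hy hz => rw [smul_add, add_smul, hy, hz, add_smul, smul_add]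

variable {M : Type u} [AddCommGroup M] [Module F M] [Module (Env F A) M]
  [IsScalarTower F (Env F A) M]

/-- The operator `(n, c) ↦ (a n + m c, a c)` on `M × A`. -/
def block (a : A) (m : M) : Module.End F (M × A) where
  toFun x := (of F a 1 • x.1 + of F 1 x.2 • m, a * x.2)
  map_add' x y := by
    ext <;> simp [add_of_right, add_smul, mul_add]
    abel
  map_smul' c x := by
    have : of F a 1 • c • x.1 = c • of F a 1 • x.1 := smul_comm _ _ _
    ext <;> simp [smul_of_right, this]

lemma block_apply (a : A) (m : M) (x : M × A) :
    block (F := F) a m x = (of F a 1 • x.1 + of F 1 x.2 • m, a * x.2) := rfl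

/-- The corner of the product is the Leibniz expression `a n + m b`; hence an algebra map whose
values are blocks is an algebra map on the diagonal together with a derivation in the corner. -/
lemma block_mul (a b : A) (m n : M) :
    block (F := F) a m * block b n = block (a * b) (of F a 1 • n + of F 1 b • m) := by
  refine LinearMap.ext fun x => ?_
  rw [Module.End.mul_apply]
  ext <;> simp [block_apply, smul_smul, of_mul, mul_assoc, add_assoc]

lemma block_add (a b : A) (m n : M) :
    block (F := F) a m + block b n = block (a + b) (m + n) := by
  refine LinearMap.ext fun x => ?_
  ext <;> simp [block_apply, add_of_left, add_smul, add_mul]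
  abel

lemma block_one : block (F := F) (1 : A) (0 : M) = 1 := by
  refine LinearMap.ext fun x => ?_
  ext <;> simp [block_apply, of_one]

lemma block_zero : block (F := F) (0 : A) (0 : M) = 0 := by
  refine LinearMap.ext fun x => ?_
  ext <;> simp [block_apply, zero_of_left]

lemma block_smul (c : F) (a : A) (m : M) :
    block (F := F) (c • a) (c • m) = c • block a m := by
  refine LinearMap.ext fun x => ?_
  have : of F 1 x.2 • c • m = c • of F 1 x.2 • m := smul_comm _ _ _
  ext <;> simp [block_apply, smul_of_left, this]

lemma sum_block {ι : Type*} (s : Finset ι) (a : ι → A) :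
    ∑ i ∈ s, block (F := F) (a i) (0 : M) = block (∑ i ∈ s, a i) 0 := by
  classical
  induction s using Finset.induction_on with
  | empty => simp [block_zero]
  | insert i s hi h => rw [Finset.sum_insert hi, Finset.sum_insert hi, h, block_add, add_zero]

end Env

open PathAlgebra

namespace QuadraticRelations

variable {F : Type u} [Field F] {Q : Type u} [Quiver.{u} Q] [Fintype Q]
  (R : QuadraticRelations F Q)

lemma proj_surjective : Function.Surjective R.proj := RingQuot.mkAlgHom_surjective F _

/-! ### Derivations with prescribed values on the arrows, and the maps they induce on `A ⊗_k A` -/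

section Derivation

variable {R}
variable {M : Type u} [AddCommGroup M] [Module F M] [Module (Env F R.Alg) M]
  [IsScalarTower F (Env F R.Alg) M] (g : Quiver.Total Q → M)
  (hl : ∀ a, Env.of F (R.proj (e F a.right)) 1 • g a = g a)
  (hr : ∀ a, Env.of F 1 (R.proj (e F a.left)) • g a = g a)

/-- The representation of the path algebra on `M × A` that encodes the derivation with value `g a`
at each arrow `a`. -/
def rep : PathAlgebra F Q →ₐ[F] Module.End F (M × R.Alg) :=
  PathAlgebra.lift F (fun i => Env.block (R.proj (e F i)) 0)
    (fun a => Env.block (R.proj (arr F a)) (g a))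
    (fun i => by rw [Env.block_mul, ← map_mul, e_mul_self]; simp)
    (fun i j h => by rw [Env.block_mul, ← map_mul, e_mul_ne F h]; simp [Env.block_zero])
    (by rw [Env.sum_block, ← map_sum, sum_e, map_one, Env.block_one])
    (fun a => by rw [Env.block_mul, ← map_mul, e_mul_arr, hl]; simp)
    (fun a => by rw [Env.block_mul, ← map_mul, arr_mul_e, hr]; simp)

/-- The derivation from the path algebra to `M` that vanishes at the vertices and has value `g a`
at each arrow `a`. -/
def pathDer : PathAlgebra F Q →ₗ[F] M :=
  LinearMap.fst F M R.Alg ∘ₗ LinearMap.applyₗ ((0, 1) : M × R.Alg) ∘ₗ (rep g hl hr).toLinearMap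

/-- Applying a block to `(0, 1)` exposes its corner, so the corner is determined by the operator. -/
lemma pathDer_eq {x : PathAlgebra F Q} {a : R.Alg} {m : M}
    (h : rep g hl hr x = Env.block a m) : pathDer g hl hr x = m := by
  change (rep g hl hr x (0, 1)).1 = m
  rw [h, Env.block_apply]
  simp [Env.of_one]

/-- Blocks are closed under sums, products and scalars, so the block form of the generators
propagates to all of the path algebra. -/
lemma exists_rep_eq (x : PathAlgebra F Q) :
    ∃ m : M, rep g hl hr x = Env.block (R.proj x) m := by
  induction x using PathAlgebra.induct with
  | he i => exact ⟨0, lift_e ..⟩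
  | ha a => exact ⟨g a, lift_arr ..⟩
  | hc c =>
    refine ⟨0, ?_⟩
    rw [AlgHom.commutes, AlgHom.commutes, Algebra.algebraMap_eq_smul_one,
      Algebra.algebraMap_eq_smul_one, ← Env.block_one, ← Env.block_smul, smul_zero]
  | hadd x y hx hy =>
    obtain ⟨m, hm⟩ := hx
    obtain ⟨n, hn⟩ := hy
    exact ⟨m + n, by rw [map_add, map_add, hm, hn, Env.block_add]⟩
  | hmul x y hx hy =>
    obtain ⟨m, hm⟩ := hx
    obtain ⟨n, hn⟩ := hy
    exact ⟨_, by rw [map_mul, map_mul, hm, hn, Env.block_mul]⟩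

lemma rep_eq (x : PathAlgebra F Q) :
    rep g hl hr x = Env.block (R.proj x) (pathDer g hl hr x) := by
  obtain ⟨m, hm⟩ := exists_rep_eq g hl hr x
  rw [pathDer_eq g hl hr hm, hm]

lemma pathDer_e (i : Q) : pathDer g hl hr (e F i) = 0 :=
  pathDer_eq g hl hr (a := R.proj (e F i)) (lift_e ..)

lemma pathDer_arr (a : Quiver.Total Q) : pathDer g hl hr (arr F a) = g a :=
  pathDer_eq g hl hr (a := R.proj (arr F a)) (lift_arr ..)

lemma pathDer_mul (x y : PathAlgebra F Q) : pathDer g hl hr (x * y) =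
    Env.of F (R.proj x) 1 • pathDer g hl hr y + Env.of F 1 (R.proj y) • pathDer g hl hr x :=
  pathDer_eq g hl hr (a := R.proj x * R.proj y) (by
    rw [map_mul, rep_eq, rep_eq, Env.block_mul])

lemma pathDer_vertex {x : PathAlgebra F Q} (hx : x ∈ vertexSpace F Q) :
    pathDer g hl hr x = 0 := by
  have : vertexSpace F Q ≤ LinearMap.ker (pathDer g hl hr) := by
    refine Submodule.span_le.2 ?_
    rintro _ ⟨i, rfl⟩
    exact pathDer_e g hl hr i
  exact this hx

/-- On a product of two arrows this is the Leibniz rule `D(b c) = b D(c) + D(b) c`. Written with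
cuts, it has the shape of the Koszul differential on `W_2`. -/
lemma pathDer_sq [Fintype (Quiver.Total Q)] {x : PathAlgebra F Q}
    (hx : x ∈ arrowSpace F Q * arrowSpace F Q) :
    pathDer g hl hr x = ∑ a : Quiver.Total Q,
      (Env.of F (R.proj (arr F a)) 1 • pathDer g hl hr (derivL F a x) +
        Env.of F 1 (R.proj (arr F a)) • pathDer g hl hr (derivR F a x)) := by
  rw [arrowSpace, Submodule.span_mul_span] at hx
  induction hx using Submodule.span_induction with
  | mem x hx =>
    obtain ⟨_, ⟨b, rfl⟩, _, ⟨c, rfl⟩, rfl⟩ := hx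
    classical
    simp only [derivL_arr_mul, derivR_mul_arr, Finset.sum_add_distrib]
    rw [Finset.sum_eq_single b, Finset.sum_eq_single c]
    · simp only [if_true, pathDer_mul, pathDer_e, smul_zero, add_zero, zero_add, smul_smul,
        Env.of_mul, ← map_mul, arr_mul_e, e_mul_arr, one_mul]
    · intro a _ h; simp [h]
    · simp
    · intro a _ h; simp [h]
    · simp
  | zero => simp
  | add x y _ _ hx hy => simp only [map_add, smul_add, hx, hy, Finset.sum_add_distrib]; abel
  | smul c x _ hx =>
    have h : ∀ (z : Env F R.Alg) (m : M), z • c • m = c • z • m := fun z m => smul_comm _ _ _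
    rw [map_smul, hx, Finset.smul_sum]
    simp only [map_smul, smul_add, h]

variable (hR : ∀ x ∈ R.R, pathDer g hl hr x = 0)

/-- The representation of `A` on `M × A` that encodes a derivation. -/
def algRep : R.Alg →ₐ[F] Module.End F (M × R.Alg) :=
  RingQuot.liftAlgHom F ⟨rep g hl hr, by
    rintro x _ ⟨hx, rfl⟩
    -- On a relation the diagonal vanishes because it is taken in `A`, and the corner vanishes by
    -- `hR`.
    rw [rep_eq, hR x hx, R.proj_eq_zero hx, Env.block_zero, map_zero]⟩

lemma algRep_proj (x : PathAlgebra F Q) :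
    algRep g hl hr hR (R.proj x) = rep g hl hr x := by
  unfold algRep proj
  exact RingQuot.liftAlgHom_mkAlgHom_apply _ _ _ _

/-- The derivation from `A` to `M` that vanishes at the vertices and has value `g a` at each
arrow `a`. -/
def der : R.Alg →ₗ[F] M :=
  LinearMap.fst F M R.Alg ∘ₗ LinearMap.applyₗ ((0, 1) : M × R.Alg) ∘ₗ
    (algRep g hl hr hR).toLinearMap

lemma der_proj (x : PathAlgebra F Q) : der g hl hr hR (R.proj x) = pathDer g hl hr x := by
  change (algRep g hl hr hR (R.proj x) (0, 1)).1 = _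
  rw [algRep_proj]
  rfl

lemma der_mul (x y : R.Alg) : der g hl hr hR (x * y) =
    Env.of F x 1 • der g hl hr hR y + Env.of F 1 y • der g hl hr hR x := by
  obtain ⟨x, rfl⟩ := R.proj_surjective x
  obtain ⟨y, rfl⟩ := R.proj_surjective y
  rw [← map_mul, der_proj, der_proj, der_proj, pathDer_mul]

/-- The map `a ⊗ b ↦ D(a) b`. -/
def derEnv : Env F R.Alg →ₗ[F] M :=
  TensorProduct.lift (LinearMap.mk₂ F
    (fun a (b : R.Algᵐᵒᵖ) => Env.of F 1 b.unop • der g hl hr hR a)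
    (fun a a' b => by rw [map_add, smul_add])
    (fun c a b => by rw [map_smul]; exact smul_comm _ _ _)
    (fun a b b' => by rw [MulOpposite.unop_add, Env.add_of_right, add_smul])
    (fun c a b => by rw [MulOpposite.unop_smul, Env.smul_of_right, smul_assoc]))

lemma derEnv_of (a b : R.Alg) :
    derEnv g hl hr hR (Env.of F a b) = Env.of F 1 b • der g hl hr hR a := rfl

/-- The map `(a ⊗ b) ⊗ w ↦ D(a w) b`. -/
def splitFree : Env F R.Alg ⊗[F] R.W 0 →ₗ[F] M :=
  TensorProduct.lift (LinearMap.mk₂ F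
    (fun z (w : R.W 0) => derEnv g hl hr hR (z * Env.of F (R.proj w) 1))
    (fun z z' w => by rw [add_mul, map_add])
    (fun c z w => by rw [smul_mul_assoc, map_smul])
    (fun z w w' => by
      rw [Submodule.coe_add, map_add, Env.add_of_left, mul_add, map_add])
    (fun c z w => by
      rw [Submodule.coe_smul, map_smul, Env.smul_of_left, mul_smul_comm, map_smul]))

lemma splitFree_tmul (z : Env F R.Alg) (w : R.W 0) : splitFree g hl hr hR (z ⊗ₜ w) =
    derEnv g hl hr hR (z * Env.of F (R.proj w) 1) := rfl

/-- Balancing on the right compares `D(a x w) y b` with `D(a x w y) b`. They agree by Leibniz, since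
`D` kills the vertex element `y`. -/
lemma splitFree_balance {t : Env F R.Alg ⊗[F] R.W 0} (ht : t ∈ R.balance 0) :
    splitFree g hl hr hR t = 0 := by
  -- `a ⊗ b ↦ D(a) b` need not be left `A`-linear, so vanishing on generators of the submodule is
  -- not enough: all their `A^e`-multiples are treated at once.
  suffices H : ∀ z : Env F R.Alg, splitFree g hl hr hR (z • t) = 0 by
    simpa using H 1
  induction ht using Submodule.span_induction with
  | mem t ht =>
    obtain ⟨x, hx, y, hy, w, w', h, rfl⟩ := ht
    intro z
    induction z using Env.induct with
    | h0 => simp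
    | hadd z z' hz hz' => rw [add_smul, map_add, hz, hz', add_zero]
    | hof a b =>
      rw [smul_sub, TensorProduct.smul_tmul', TensorProduct.smul_tmul', map_sub,
        splitFree_tmul, splitFree_tmul, smul_eq_mul, smul_eq_mul, mul_one, Env.of_mul, Env.of_mul,
        Env.of_mul, derEnv_of, derEnv_of, h, map_mul R.proj, map_mul R.proj, ← mul_assoc a (_ * _) (R.proj y),
        der_mul _ _ _ _ _ (R.proj y), der_proj, pathDer_vertex _ _ _ hy, smul_zero, zero_add,
        smul_smul, Env.of_mul]
      simp [mul_assoc]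
  | zero => simp
  | add x y _ _ hx hy => intro z; rw [smul_add, map_add, hx, hy, add_zero]
  | smul c x _ hx => intro z; rw [smul_smul]; exact hx _

/-- The map `A ⊗_k k ⊗_k A → M` that sends `a ⊗ b` to `D(a) b`. -/
def split : R.Term 0 →ₗ[F] M :=
  ((R.balance 0).restrictScalars F).liftQ (splitFree g hl hr hR)
    fun _ ht => splitFree_balance g hl hr hR ht

lemma split_smul_incl (z : Env F R.Alg) (w : R.W 0) : split g hl hr hR (z • R.incl 0 w) =
    derEnv g hl hr hR (z * Env.of F (R.proj w) 1) := by
  rw [smul_incl, ← splitFree_tmul]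
  rfl

end Derivation

/-! ### Generators of the Koszul terms and the augmentation -/

lemma term_induct {p : ℕ} {P : R.Term p → Prop} (h0 : P 0)
    (hincl : ∀ (a b : R.Alg) w, P (Env.of F a b • R.incl p w))
    (hadd : ∀ x y, P x → P y → P (x + y)) (t : R.Term p) : P t := by
  obtain ⟨t, rfl⟩ := Submodule.Quotient.mk_surjective _ t
  induction t using TensorProduct.induction_on with
  | zero => exact h0
  | add x y hx hy => exact hadd _ _ hx hy
  | tmul z w =>
    change P ((R.balance p).mkQ (z ⊗ₜ w))
    rw [← smul_incl]
    induction z using Env.induct with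
    | h0 => rwa [zero_smul]
    | hof a b => exact hincl a b w
    | hadd x y hx hy => rw [add_smul]; exact hadd _ _ hx hy

/-- A vertex, as an element of `W_0`. -/
def vtx (i : Q) : R.W 0 := ⟨e F i, Submodule.subset_span ⟨i, rfl⟩⟩

/-- An arrow, as an element of `W_1`. -/
def arw (a : Quiver.Total Q) : R.W 1 := ⟨arr F a, Submodule.subset_span ⟨a, rfl⟩⟩

lemma term_zero_induct {P : R.Term 0 → Prop} (h0 : P 0)
    (hincl : ∀ (a b : R.Alg) i, P (Env.of F a b • R.incl 0 (R.vtx i)))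
    (hadd : ∀ x y, P x → P y → P (x + y)) (t : R.Term 0) : P t := by
  induction t using R.term_induct with
  | h0 => exact h0
  | hadd x y hx hy => exact hadd x y hx hy
  | hincl a b w =>
    obtain ⟨w, hw⟩ := w
    change w ∈ vertexSpace F Q at hw
    induction hw using Submodule.span_induction generalizing a with
    | mem x hx => obtain ⟨i, rfl⟩ := hx; exact hincl a b i
    | zero =>
      change P (Env.of F a b • R.incl 0 0)
      simpa using h0
    | add x y hx' hy' hx hy =>
      change P (Env.of F a b • R.incl 0 (⟨x, hx'⟩ + ⟨y, hy'⟩))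
      rw [map_add, smul_add]
      exact hadd _ _ (hx a) (hy a)
    | smul c x hx' hx =>
      change P (Env.of F a b • R.incl 0 (c • ⟨x, hx'⟩))
      -- The scalar is absorbed into the left factor, which is why the induction generalizes `a`.
      rw [map_smul, smul_comm, ← smul_assoc, ← Env.smul_of_left]
      exact hx _

lemma term_one_induct {P : R.Term 1 → Prop} (h0 : P 0)
    (hincl : ∀ (a b : R.Alg) c, P (Env.of F a b • R.incl 1 (R.arw c)))
    (hadd : ∀ x y, P x → P y → P (x + y)) (t : R.Term 1) : P t := by
  induction t using R.term_induct with
  | h0 => exact h0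
  | hadd x y hx hy => exact hadd x y hx hy
  | hincl a b w =>
    obtain ⟨w, hw⟩ := w
    change w ∈ arrowSpace F Q at hw
    induction hw using Submodule.span_induction generalizing a with
    | mem x hx => obtain ⟨c, rfl⟩ := hx; exact hincl a b c
    | zero =>
      change P (Env.of F a b • R.incl 1 0)
      simpa using h0
    | add x y hx' hy' hx hy =>
      change P (Env.of F a b • R.incl 1 (⟨x, hx'⟩ + ⟨y, hy'⟩))
      rw [map_add, smul_add]
      exact hadd _ _ (hx a) (hy a)
    | smul c x hx' hx =>
      change P (Env.of F a b • R.incl 1 (c • ⟨x, hx'⟩))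
      rw [map_smul, smul_comm, ← smul_assoc, ← Env.smul_of_left]
      exact hx _

lemma incl_arw_left (a : Quiver.Total Q) :
    Env.of F (R.proj (e F a.right)) 1 • R.incl 1 (R.arw a) = R.incl 1 (R.arw a) := by
  rw [← map_one R.proj]
  exact R.incl_balance 1 (Submodule.subset_span ⟨_, rfl⟩) (one_mem_vertexSpace F)
    (by rw [mul_one]; exact (e_mul_arr F a).symm)

lemma incl_arw_right (a : Quiver.Total Q) :
    Env.of F 1 (R.proj (e F a.left)) • R.incl 1 (R.arw a) = R.incl 1 (R.arw a) := by
  rw [← map_one R.proj]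
  exact R.incl_balance 1 (one_mem_vertexSpace F) (Submodule.subset_span ⟨_, rfl⟩)
    (by rw [one_mul]; exact (arr_mul_e F a).symm)

/-- The map `z ⊗ w ↦ z • w` from the free bimodule on `W_0` to `A`. -/
def augFree : Env F R.Alg ⊗[F] R.W 0 →ₗ[Env F R.Alg] R.Alg :=
  TensorProduct.AlgebraTensorModule.lift
    (LinearMap.toSpanSingleton (Env F R.Alg) (R.W 0 →ₗ[F] R.Alg)
      (R.proj.toLinearMap ∘ₗ (R.W 0).subtype))

lemma augFree_tmul (z : Env F R.Alg) (w : R.W 0) : R.augFree (z ⊗ₜ w) = z • R.proj w := by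
  simp [augFree]

/-- The augmentation `A ⊗_k A → A` of the Koszul complex. -/
def aug : R.Term 0 →ₗ[Env F R.Alg] R.Alg :=
  (R.balance 0).liftQ R.augFree (by
    refine Submodule.span_le.2 ?_
    rintro _ ⟨x, hx, y, hy, w, w', h, rfl⟩
    rw [SetLike.mem_coe, LinearMap.mem_ker, map_sub, augFree_tmul, augFree_tmul,
      Env.of_smul_regular, one_smul, h, map_mul, map_mul, sub_self])

lemma aug_incl (w : R.W 0) : R.aug (R.incl 0 w) = R.proj w := by
  change R.augFree (1 ⊗ₜ w) = _
  rw [augFree_tmul, one_smul]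

/-- The element `1 ⊗ 1` of `A ⊗_k A`. -/
def unit : R.Term 0 := R.incl 0 ⟨1, one_mem_vertexSpace F⟩

lemma of_smul_unit {x : PathAlgebra F Q} (hx : x ∈ vertexSpace F Q) :
    Env.of F (R.proj x) 1 • R.unit = R.incl 0 ⟨x, hx⟩ := by
  rw [unit, ← map_one R.proj]
  exact R.incl_balance 0 hx (one_mem_vertexSpace F) (by simp)

lemma smul_unit_of {x : PathAlgebra F Q} (hx : x ∈ vertexSpace F Q) :
    Env.of F 1 (R.proj x) • R.unit = R.incl 0 ⟨x, hx⟩ := by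
  rw [unit, ← map_one R.proj]
  exact R.incl_balance 0 (one_mem_vertexSpace F) hx (by simp)

lemma aug_surjective : Function.Surjective R.aug := fun a =>
  ⟨Env.of F a 1 • R.unit, by
    rw [map_smul, unit, aug_incl, Env.of_smul_regular]; simp⟩

/-- Both sides are linear in `v` and agree on arrows. This turns values of the derivation on cuts of
a relation into values of `q`. -/
lemma pathDer_arrowSpace {M : Type u} [AddCommGroup M] [Module F M] [Module (Env F R.Alg) M]
    [IsScalarTower F (Env F R.Alg) M] (q : R.Term 1 →ₗ[Env F R.Alg] M)
    (hl : ∀ a, Env.of F (R.proj (e F a.right)) 1 • q (R.incl 1 (R.arw a)) = q (R.incl 1 (R.arw a)))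
    (hr : ∀ a, Env.of F 1 (R.proj (e F a.left)) • q (R.incl 1 (R.arw a)) = q (R.incl 1 (R.arw a)))
    (v : R.W 1) : pathDer (fun a => q (R.incl 1 (R.arw a))) hl hr v = q (R.incl 1 v) := by
  obtain ⟨v, hv⟩ := v
  change v ∈ arrowSpace F Q at hv
  induction hv using Submodule.span_induction with
  | mem x hx => obtain ⟨c, rfl⟩ := hx; exact pathDer_arr _ hl hr c
  | zero =>
    change pathDer _ hl hr 0 = q (R.incl 1 0)
    simp
  | add x y hx' hy' hx hy =>
    change pathDer _ hl hr (x + y) = q (R.incl 1 (⟨x, hx'⟩ + ⟨y, hy'⟩))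
    rw [map_add, map_add, map_add, ← hx, ← hy]
  | smul c x hx' hx =>
    change pathDer _ hl hr (c • x) = q (R.incl 1 (c • ⟨x, hx'⟩))
    rw [map_smul, map_smul, LinearMap.map_smul_of_tower]
    exact congrArg (c • ·) hx

/-! ### Exactness of the augmented Koszul complex in degrees `0` and `1` -/

section

variable [Fintype (Quiver.Total Q)]

lemma d_zero_arw (a : Quiver.Total Q) : R.d 0 (R.incl 1 (R.arw a)) =
    Env.of F (R.proj (arr F a)) 1 • R.incl 0 (R.vtx a.left) -
      Env.of F 1 (R.proj (arr F a)) • R.incl 0 (R.vtx a.right) := by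
  classical
  have h1 : ∀ b, R.leftCut 0 b (R.arw a) = if b = a then R.vtx a.left else 0 := fun b => by
    ext
    change derivL F b (arr F a) = _
    rw [derivL_arr]
    split_ifs <;> rfl
  have h2 : ∀ b, R.rightCut 0 b (R.arw a) = if b = a then R.vtx a.right else 0 := fun b => by
    ext
    change derivR F b (arr F a) = _
    rw [derivR_arr]
    split_ifs <;> rfl
  rw [d_incl, dGen_apply, Finset.sum_eq_single a]
  · rw [h1, h2, if_pos rfl, if_pos rfl, zero_add, pow_one, neg_smul, one_smul, sub_eq_add_neg]
  · intro b _ hb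
    rw [h1, h2, if_neg hb, if_neg hb]
    simp
  · simp

/-- The differential gives `x a ⊗ y - x ⊗ a y`, which goes to `D(x a) y - D(x) a y = x D(a) y` by
Leibniz. -/
lemma split_d_zero {M : Type u} [AddCommGroup M] [Module F M] [Module (Env F R.Alg) M]
    [IsScalarTower F (Env F R.Alg) M] (g : Quiver.Total Q → M)
    (hl : ∀ a, Env.of F (R.proj (e F a.right)) 1 • g a = g a)
    (hr : ∀ a, Env.of F 1 (R.proj (e F a.left)) • g a = g a)
    (hR : ∀ x ∈ R.R, pathDer g hl hr x = 0) (x y : R.Alg) (a : Quiver.Total Q) :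
    split g hl hr hR (R.d 0 (Env.of F x y • R.incl 1 (R.arw a))) = Env.of F x y • g a := by
  have he : ∀ i : Q, der g hl hr hR (R.proj (e F i)) = 0 := fun i => by
    rw [der_proj, pathDer_e]
  have h1 : R.proj (arr F a) * R.proj (e F a.left) = R.proj (arr F a) := by
    rw [← map_mul, arr_mul_e]
  have h2 : R.proj (e F a.right) * R.proj (arr F a) = R.proj (arr F a) := by
    rw [← map_mul, e_mul_arr]
  rw [map_smul, d_zero_arw, smul_sub, smul_smul, smul_smul, map_sub, split_smul_incl,
    split_smul_incl]
  simp only [Env.of_mul, vtx, mul_one, one_mul, mul_assoc, h1, derEnv_of, der_mul, he, smul_zero,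
    zero_add, smul_smul, smul_add, der_proj, pathDer_arr]
  rw [← mul_assoc, h2]
  abel

/-- A bimodule map `q` that kills the image of `d_1` factors through `d_0`: its values on the arrows
extend to a derivation of `A`, and the resulting map `split` satisfies `split ∘ d_0 = q`. Taking for
`q` the quotient by the image of `d_1` gives exactness in degree `1`. -/
lemma apply_eq_zero_of_d_zero_eq_zero {M : Type u} [AddCommGroup M] [Module F M]
    [Module (Env F R.Alg) M] [IsScalarTower F (Env F R.Alg) M] (q : R.Term 1 →ₗ[Env F R.Alg] M)
    (hq : ∀ s, q (R.d 1 s) = 0) {t : R.Term 1} (ht : R.d 0 t = 0) : q t = 0 := by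
  have hl : ∀ a, Env.of F (R.proj (e F a.right)) 1 • q (R.incl 1 (R.arw a)) =
      q (R.incl 1 (R.arw a)) := fun a => by
    rw [← map_smul, incl_arw_left]
  have hr : ∀ a, Env.of F 1 (R.proj (e F a.left)) • q (R.incl 1 (R.arw a)) =
      q (R.incl 1 (R.arw a)) := fun a => by
    rw [← map_smul, incl_arw_right]
  have hR : ∀ x ∈ R.R, pathDer (fun a => q (R.incl 1 (R.arw a))) hl hr x = 0 := by
    intro x hx
    have hx2 : x ∈ R.W 2 := R.mem_W_add_two.2 fun i j h => by
      obtain ⟨rfl, rfl⟩ : i = 0 ∧ j = 0 := by omega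
      simpa using hx
    -- The derivation of a relation is `q` of its Koszul differential: the sign on `W_2` is `(-1)^2
    -- = 1`, so the two sums match term by term.
    rw [← hq (R.incl 2 ⟨x, hx2⟩), d_incl, dGen_apply, pathDer_sq _ hl hr (R.le_sq hx), map_sum]
    refine Finset.sum_congr rfl fun a _ => ?_
    rw [map_add, neg_one_sq, one_smul, map_smul q, map_smul q,
      ← R.pathDer_arrowSpace q hl hr, ← R.pathDer_arrowSpace q hl hr]
    rfl
  have key : ∀ s, split _ hl hr hR (R.d 0 s) = q s := by
    intro s
    induction s using R.term_one_induct with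
    | h0 => simp
    | hincl a b c => rw [split_d_zero, map_smul]
    | hadd x y hx hy => rw [map_add, map_add, map_add, hx, hy]
  rw [← key, ht, map_zero]

/-- The Koszul complex is exact in degree `1`. -/
lemma exact_d_one_d_zero : Function.Exact (R.d 1) (R.d 0) := by
  intro t
  refine ⟨fun ht => ?_, ?_⟩
  · exact (Submodule.Quotient.mk_eq_zero _).1 (R.apply_eq_zero_of_d_zero_eq_zero
      (LinearMap.range (R.d 1)).mkQ (fun s => (Submodule.Quotient.mk_eq_zero _).2 ⟨s, rfl⟩) ht)
  · rintro ⟨s, rfl⟩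
    exact LinearMap.congr_fun (R.d_comp_d 0) s

lemma aug_d : R.aug ∘ₗ R.d 0 = 0 := by
  refine LinearMap.ext fun t => ?_
  induction t using R.term_one_induct with
  | h0 => simp
  | hadd x y hx hy => rw [map_add, map_add, hx, hy]
  | hincl a b c =>
    rw [map_smul, LinearMap.comp_apply, d_zero_arw, map_sub, map_smul, map_smul, aug_incl, aug_incl]
    simp only [Env.of_smul_regular, vtx, one_mul, mul_one, ← map_mul, arr_mul_e, e_mul_arr]
    simp

/-- The differential of an arrow `a` is the commutator of `a` with `1 ⊗ 1`. Commutators of products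
follow from `[x y, u] = x [y, u] + [x, u] y`. -/
lemma unit_central (x : PathAlgebra F Q) :
    Env.of F (R.proj x) 1 • R.unit - Env.of F 1 (R.proj x) • R.unit ∈
      LinearMap.range (R.d 0) := by
  induction x using PathAlgebra.induct with
  | he i =>
    rw [of_smul_unit _ (Submodule.subset_span ⟨i, rfl⟩),
      smul_unit_of _ (Submodule.subset_span ⟨i, rfl⟩), sub_self]
    exact zero_mem _
  | ha a =>
    refine ⟨R.incl 1 (R.arw a), ?_⟩
    have hl : R.incl 0 (R.vtx a.left) = Env.of F (R.proj (e F a.left)) 1 • R.unit :=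
      (R.of_smul_unit _).symm
    have hr : R.incl 0 (R.vtx a.right) = Env.of F 1 (R.proj (e F a.right)) • R.unit :=
      (R.smul_unit_of _).symm
    rw [d_zero_arw, hl, hr, smul_smul, smul_smul, Env.of_mul, Env.of_mul, ← map_mul, ← map_mul,
      arr_mul_e, e_mul_arr, one_mul]
  | hc c =>
    rw [Algebra.algebraMap_eq_smul_one, map_smul, map_one, Env.smul_of_left, Env.smul_of_right,
      sub_self]
    exact zero_mem _
  | hadd x y hx hy =>
    rw [map_add, Env.add_of_left, Env.add_of_right, add_smul, add_smul, add_sub_add_comm]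
    exact add_mem hx hy
  | hmul x y hx hy =>
    have h := add_mem (Submodule.smul_mem _ (Env.of F (R.proj x) 1) hy)
      (Submodule.smul_mem _ (Env.of F 1 (R.proj y)) hx)
    simp only [smul_sub, smul_smul, Env.of_mul, mul_one, one_mul, ← map_mul] at h
    rwa [sub_add_sub_cancel] at h

/-- The augmented Koszul complex is exact in degree `0`. -/
lemma exact_d_zero_aug : Function.Exact (R.d 0) R.aug := by
  intro t
  refine ⟨fun ht => ?_, ?_⟩
  swap
  · rintro ⟨s, rfl⟩
    exact LinearMap.congr_fun R.aug_d s
  -- Modulo boundaries the right factor can be moved across `1 ⊗ 1`, so `t` is congruent to `aug(t)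
  -- ⊗ 1`.
  have key : ∀ t, t - Env.of F (R.aug t) 1 • R.unit ∈ LinearMap.range (R.d 0) := by
    intro t
    induction t using R.term_zero_induct with
    | h0 => rw [map_zero, Env.zero_of_left, zero_smul, sub_self]; exact zero_mem _
    | hadd x y hx hy =>
      rw [map_add, Env.add_of_left, add_smul, add_sub_add_comm]
      exact add_mem hx hy
    | hincl a b i =>
      obtain ⟨b, rfl⟩ := R.proj_surjective b
      have hi : R.incl 0 (R.vtx i) = Env.of F (R.proj (e F i)) 1 • R.unit :=
        (R.of_smul_unit _).symm
      have h := Submodule.neg_mem _ (Submodule.smul_mem _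
        (Env.of F (a * R.proj (e F i)) 1) (R.unit_central b))
      rw [map_smul, aug_incl, Env.of_smul_regular, hi]
      simp only [smul_sub, smul_smul, Env.of_mul, mul_one, one_mul, neg_sub] at h ⊢
      exact h
  have := key t
  rw [ht, Env.zero_of_left, zero_smul, sub_zero] at this
  exact this

end

end QuadraticRelations

/-! ### Maps in the derived category into an object placed in one degree -/

section Abelian

universe w v

variable {C : Type u} [Category.{v} C] [Abelian C]

open HomologicalComplex

/-- Each map `P^m → E` that vanishes on boundaries extends along the
differential. -/
def CocyclesExtend (P : CochainComplex C ℤ) (E : C) (a m b : ℤ) : Prop :=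
  ∀ φ : P.X m ⟶ E, P.d a m ≫ φ = 0 → ∃ ψ : P.X b ⟶ E, φ = P.d m b ≫ ψ

lemma homotopic_zero_of_factors {P : CochainComplex C ℤ} {E : C} {m b : ℤ} (hb : m + 1 = b)
    (φ : P ⟶ (single C (ComplexShape.up ℤ) m).obj E) (ψ : P.X b ⟶ E)
    (h : φ.f m ≫ (singleObjXSelf (ComplexShape.up ℤ) m E).hom = P.d m b ≫ ψ) :
    Nonempty (Homotopy φ 0) := by
  subst hb
  -- The homotopy has a single nonzero component, `ψ` from degree `m + 1` to degree `m`; the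
  -- isomorphisms only transport along equalities of degrees.
  let s : ∀ i j, (ComplexShape.up ℤ).Rel j i →
      (P.X i ⟶ ((single C (ComplexShape.up ℤ) m).obj E).X j) := fun i j hij =>
    if hj : j = m then
      (P.XIsoOfEq (show i = m + 1 by rw [← hj]; exact hij.symm)).hom ≫ ψ ≫
        (singleObjXIsoOfEq (ComplexShape.up ℤ) m E j hj).inv
    else 0
  have hs : φ = Homotopy.nullHomotopicMap' s := by
    refine to_single_hom_ext ?_
    rw [Homotopy.nullHomotopicMap'_f (k₂ := m - 1) (k₁ := m) (k₀ := m + 1) (by simp) (by simp)]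
    have : s (m + 1) m (by simp) = ψ ≫ (singleObjXSelf (ComplexShape.up ℤ) m E).inv := by
      simp [s, singleObjXSelf]
    rw [this, ← Category.assoc, ← h]
    simp
  exact ⟨(Homotopy.ofEq hs).trans (Homotopy.nullHomotopy' s)⟩

lemma shift_exactAt_iff (X : CochainComplex C ℤ) (n i j : ℤ) (h : n + i = j) :
    (X⟦n⟧).ExactAt i ↔ X.ExactAt j :=
  ShortComplex.exact_iff_of_iso
    ((CochainComplex.shiftShortComplexFunctorIso C n i j h).app X)

variable [HasDerivedCategory.{w} C]

open DerivedCategory Pretriangulated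

/-- By K-projectivity, maps out of `P` in the derived category are homotopy classes of chain maps. A
chain map to `E` in degree `m` is a map `P^m → E` that kills boundaries, and it is null-homotopic
exactly when it factors through the differential out of `P^m`. -/
lemma hom_single_eq_zero_iff (P : CochainComplex C ℤ) [P.IsKProjective] (E : C) {a m b : ℤ}
    (ha : a + 1 = m) (hb : m + 1 = b) :
    (∀ f : Q.obj P ⟶ Q.obj ((single C (ComplexShape.up ℤ) m).obj E), f = 0) ↔
      CocyclesExtend P E a m b := by
  constructor
  · intro H φ hφ
    let Φ : P ⟶ (single C (ComplexShape.up ℤ) m).obj E := mkHomToSingle φ (by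
      intro i hi
      obtain rfl : i = a := by
        have : i + 1 = m := hi
        omega
      exact hφ)
    have h0 : (HomotopyCategory.quotient C (ComplexShape.up ℤ)).map Φ = 0 := by
      apply (CochainComplex.IsKProjective.Qh_map_bijective P _).injective
      have := quotientCompQhIso_hom_naturality Φ
      rw [H (Q.map Φ), Limits.comp_zero] at this
      rw [Functor.map_zero, ← cancel_mono ((quotientCompQhIso C).hom.app _), this,
        Limits.zero_comp]
    obtain ⟨h⟩ := (HomotopyCategory.quotient_map_eq_zero_iff _).1 h0
    have hc := h.comm m
    -- In degree `m` the second term of the homotopy identity ends with a differential of the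
    -- one-degree complex, hence vanishes.
    rw [dNext_eq _ (show (ComplexShape.up ℤ).Rel m b from hb),
      prevD_eq _ (show (ComplexShape.up ℤ).Rel a m from ha), single_obj_d, Limits.comp_zero,
      add_zero, zero_f_apply, add_zero] at hc
    refine ⟨h.hom b m ≫ (singleObjXSelf (ComplexShape.up ℤ) m E).hom, ?_⟩
    rw [← Category.assoc, ← hc]
    simp [Φ]
  · intro H f
    obtain ⟨g, hg⟩ := (CochainComplex.IsKProjective.Qh_map_bijective P _).surjective
      ((quotientCompQhIso C).hom.app P ≫ f ≫ (quotientCompQhIso C).inv.app _)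
    obtain ⟨Φ, rfl⟩ := (HomotopyCategory.quotient C (ComplexShape.up ℤ)).map_surjective g
    obtain ⟨ψ, hψ⟩ := H (Φ.f m ≫ (singleObjXSelf (ComplexShape.up ℤ) m E).hom) (by
      rw [← Category.assoc, ← Φ.comm, single_obj_d, Limits.comp_zero, Limits.zero_comp])
    rw [(HomotopyCategory.quotient_map_eq_zero_iff _).2 (homotopic_zero_of_factors hb Φ ψ hψ),
      Functor.map_zero] at hg
    rw [← cancel_epi ((quotientCompQhIso C).hom.app P),
      ← cancel_mono ((quotientCompQhIso C).inv.app _), Category.assoc, ← hg,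
      Limits.comp_zero, Limits.zero_comp]

/-- In the long exact sequence, `H^j(cone)` lies between `H^j(Y)` and `H^{j+1}(X)`. For `j > n` both
adjacent maps vanish. At `j = n + 1` the incoming one does so because `H^{n+1}(Y) = 0`, so nothing
is required of `ε` in that degree. -/
lemma mappingCone_isLE {X Y : CochainComplex C ℤ} (ε : X ⟶ Y) (n : ℤ)
    (hε : ∀ j, n + 2 ≤ j → QuasiIsoAt ε j) (hY : Y.ExactAt (n + 1)) :
    (CochainComplex.mappingCone ε).IsLE n := by
  rw [CochainComplex.isLE_iff]
  intro j hj
  have hT := mappingCone_triangle_distinguished ε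
  have hm2 : homologyMap (CochainComplex.mappingCone.triangle ε).mor₂ j = 0 := by
    rcases eq_or_lt_of_le (show n + 1 ≤ j by omega) with rfl | h
    · exact (hY.isZero_homology).eq_of_src _ _
    · have := hε j (by omega)
      have h0 := CochainComplex.homologyMap_comp_eq_zero_of_distTriang _ hT j
      have : Epi (homologyMap (CochainComplex.mappingCone.triangle ε).mor₁ j) :=
        inferInstanceAs (Epi (homologyMap ε j))
      rwa [← cancel_epi (homologyMap (CochainComplex.mappingCone.triangle ε).mor₁ j),
        Limits.comp_zero]
  have hd : CochainComplex.homologyδOfTriangle (CochainComplex.mappingCone.triangle ε) j (j + 1) =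
      0 := by
    have := hε (j + 1) (by omega)
    have h0 := CochainComplex.homologyδOfTriangle_homologyMap _ hT j (j + 1)
    have : Mono (homologyMap (CochainComplex.mappingCone.triangle ε).mor₁ (j + 1)) :=
      inferInstanceAs (Mono (homologyMap ε (j + 1)))
    rwa [← cancel_mono (homologyMap (CochainComplex.mappingCone.triangle ε).mor₁ (j + 1)),
      Limits.zero_comp]
  rw [exactAt_iff_isZero_homology]
  exact (CochainComplex.homologyMap_exact₃_of_distTriang _ hT j (j + 1)).isZero_of_both_zeros
    hm2 hd

/-- In the triangle `cone[-1] → X → Y` the first object lives in degrees `≤ n + 1 < m`. By the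
t-structure it has no nonzero map to `E` in degree `m`, so `f` factors through `ε`. -/
lemma hom_single_eq_zero_of_quasiIsoAt {X Y : CochainComplex C ℤ} (ε : X ⟶ Y) (n : ℤ)
    (hε : ∀ j, n + 2 ≤ j → QuasiIsoAt ε j) (hY : Y.ExactAt (n + 1)) (E : C) {m : ℤ}
    (hm : n + 2 ≤ m)
    (H : ∀ f : Q.obj Y ⟶ Q.obj ((single C (ComplexShape.up ℤ) m).obj E), f = 0)
    (f : Q.obj X ⟶ Q.obj ((single C (ComplexShape.up ℤ) m).obj E)) : f = 0 := by
  have hT := inv_rot_of_distTriang _ (mappingCone_triangle_distinguished ε)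
  have := mappingCone_isLE ε n hε hY
  have h1 : (Q.obj (CochainComplex.mappingCone ε)).IsLE n := inferInstance
  have h2 : ((Q.obj (CochainComplex.mappingCone ε))⟦(-1 : ℤ)⟧).IsLE (n + 1) :=
    TStructure.t.isLE_shift _ n (-1) (n + 1) (by omega)
  have h3 : (Q.obj ((single C (ComplexShape.up ℤ) m).obj E)).IsGE m :=
    inferInstanceAs (((singleFunctor C m).obj E).IsGE m)
  obtain ⟨g, hg⟩ := Triangle.yoneda_exact₂ _ hT f
    (TStructure.t.zero_of_isLE_of_isGE _ (n + 1) m (by omega) h2 h3)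
  exact hg.trans ((congrArg (_ ≫ ·) (H g)).trans Limits.comp_zero)

lemma exactAt_iff_of_iso {X Y : CochainComplex C ℤ} (e : Q.obj X ≅ Q.obj Y) (i : ℤ) :
    X.ExactAt i ↔ Y.ExactAt i := by
  rw [exactAt_iff_isZero_homology, exactAt_iff_isZero_homology]
  exact ((homologyFunctorFactors C i).symm.app X ≪≫
    (DerivedCategory.homologyFunctor C i).mapIso e ≪≫
      (homologyFunctorFactors C i).app Y).isZero_iff

end Abelian

open HomologicalComplex

/-! ### Cohomology of the dual complex as Ext groups with values in `A^e` -/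

section Duality

variable {F : Type u} [Field F] {A : Type u} [Ring A] [Algebra F A]

variable (F A) in
/-- The bimodule `A^e`, placed in degree `-i`. -/
def envComplex (i : ℤ) : CochainComplex (Bimod F A) ℤ :=
  (single (Bimod F A) (ComplexShape.up ℤ) (-i)).obj (ModuleCat.of (Env F A) (Env F A))

lemma dualComplex_exactAt_iff (P : CochainComplex (Bimod F A) ℤ) (i : ℤ) :
    (dualComplex P).ExactAt i ↔
      CocyclesExtend P (ModuleCat.of (Env F A) (Env F A)) (-(i + 1)) (-i) (-(i - 1)) := by
  rw [exactAt_iff' (dualComplex P) (i - 1) i (i + 1) (by simp) (by simp),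
    ShortComplex.moduleCat_exact_iff]
  constructor
  · intro H φ hφ
    obtain ⟨ψ, hψ⟩ := H (show Env.Dual F A (P.X (-i)) from φ.hom)
      (congrArg ModuleCat.Hom.hom hφ)
    exact ⟨ModuleCat.ofHom (show P.X (-(i - 1)) →ₗ[Env F A] Env F A from ψ),
      ModuleCat.hom_ext hψ.symm⟩
  · intro H x hx
    obtain ⟨ψ, hψ⟩ := H (ModuleCat.ofHom (show P.X (-i) →ₗ[Env F A] Env F A from x))
      (ModuleCat.hom_ext hx)
    exact ⟨(show Env.Dual F A (P.X (-(i - 1))) from ψ.hom),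
      (congrArg ModuleCat.Hom.hom hψ).symm⟩

/-- Both sides say that `Ext^i(X, A^e) = 0`: the left through the cohomology of the dual of the
resolution `P`, the right through maps out of `P`, which is isomorphic to `X` in the derived
category. -/
lemma RHomEnvIso.exactAt_iff {X Y : CochainComplex (Bimod F A) ℤ} (h : RHomEnvIso X Y) (i : ℤ) :
    letI := HasDerivedCategory.standard (Bimod F A)
    Y.ExactAt i ↔ ∀ f : DerivedCategory.Q.obj X ⟶ DerivedCategory.Q.obj (envComplex F A i),
      f = 0 := by
  let := HasDerivedCategory.standard (Bimod F A)
  obtain ⟨P, π, hP, hπ, ⟨e⟩⟩ := h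
  rw [← exactAt_iff_of_iso e, dualComplex_exactAt_iff,
    ← hom_single_eq_zero_iff P _ (by ring) (by ring)]
  constructor
  · intro H f
    rw [← cancel_epi (DerivedCategory.Q.map π), Limits.comp_zero]
    exact H _
  · intro H f
    rw [← cancel_epi (inv (DerivedCategory.Q.map π)), Limits.comp_zero]
    exact H _

lemma RHomEnvIso.exactAt_of_exactAt {X X' Y Y' : CochainComplex (Bimod F A) ℤ}
    (h : RHomEnvIso X Y) (h' : RHomEnvIso X' Y') (ε : X ⟶ X') (n : ℤ)
    (hε : ∀ j, n + 2 ≤ j → QuasiIsoAt ε j) (hX' : X'.ExactAt (n + 1)) {i : ℤ} (hi : n + 2 ≤ -i)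
    (hY' : Y'.ExactAt i) : Y.ExactAt i := by
  let := HasDerivedCategory.standard (Bimod F A)
  refine (h.exactAt_iff i).2 fun f => ?_
  exact hom_single_eq_zero_of_quasiIsoAt ε n hε hX' _ hi ((h'.exactAt_iff i).1 hY') f

variable (F A) in
lemma regularComplex_exactAt {i : ℤ} (hi : i ≠ 0) : (regularComplex F A).ExactAt i :=
  ExactAt.of_isZero (isZero_single_obj_X _ _ _ _ hi)

end Duality

/-! ### Comparison of `K(A)` with `A`, and the vanishing of homology -/

namespace QuadraticRelations

variable {F : Type u} [Field F] {Q : Type u} [Quiver.{u} Q] [Fintype Q]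
  [Fintype (Quiver.Total Q)] (R : QuadraticRelations F Q)

lemma koszulComplex_d (p : ℕ) : R.koszulComplex.d (p + 1) p = ModuleCat.ofHom (R.d p) :=
  ChainComplex.of_d (fun p => ModuleCat.of (Env F R.Alg) (R.Term p))
    (fun p => ModuleCat.ofHom (R.d p)) p

/-- The augmentation of the Koszul complex, as a map of chain complexes. -/
def augChain : R.koszulComplex ⟶
    (ChainComplex.single₀ (Bimod F R.Alg)).obj (ModuleCat.of (Env F R.Alg) R.Alg) :=
  (ChainComplex.toSingle₀Equiv _ _).symm ⟨ModuleCat.ofHom R.aug, by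
    rw [koszulComplex_d]
    exact ModuleCat.hom_ext R.aug_d⟩

lemma koszulComplex_exactAt_one : R.koszulComplex.ExactAt 1 := by
  rw [exactAt_iff' R.koszulComplex 2 1 0 (by simp) (by simp), ShortComplex.moduleCat_exact_iff]
  intro x hx
  change R.koszulComplex.d (0 + 1) 0 x = 0 at hx
  rw [koszulComplex_d] at hx
  obtain ⟨y, hy⟩ := (R.exact_d_one_d_zero x).1 hx
  refine ⟨y, ?_⟩
  change R.koszulComplex.d (1 + 1) 1 y = x
  rw [koszulComplex_d]
  exact hy

lemma quasiIsoAt_augChain_one : QuasiIsoAt R.augChain 1 := by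
  rw [quasiIsoAt_iff_exactAt _ _ R.koszulComplex_exactAt_one]
  exact ExactAt.of_isZero (isZero_single_obj_X _ _ _ _ one_ne_zero)

lemma quasiIsoAt_augChain_zero : QuasiIsoAt R.augChain 0 := by
  have h0 : R.augChain.f 0 = ModuleCat.ofHom R.aug :=
    ChainComplex.toSingle₀Equiv_symm_apply_f_zero _ _
  rw [ChainComplex.quasiIsoAt₀_iff, ShortComplex.quasiIso_iff_of_zeros']
  · refine ⟨?_, ?_⟩
    · rw [ShortComplex.moduleCat_exact_iff]
      intro x hx
      change R.augChain.f 0 x = 0 at hx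
      rw [h0] at hx
      obtain ⟨y, hy⟩ := (R.exact_d_zero_aug x).1 hx
      refine ⟨y, ?_⟩
      change R.koszulComplex.d (0 + 1) 0 y = x
      rw [koszulComplex_d]
      exact hy
    · change Epi (R.augChain.f 0)
      rw [h0]
      exact (ModuleCat.epi_iff_surjective _).2 R.aug_surjective
  · exact R.koszulComplex.shape _ _ (by simp)
  · rfl
  · rfl

/-- The augmentation of the Koszul complex, as a map of cochain complexes. -/
def augCochain : R.koszulCochainComplex ⟶ regularComplex F R.Alg :=
  extendMap R.augChain ComplexShape.embeddingDownNat ≫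
    (extendSingleIso ComplexShape.embeddingDownNat _ 0 0 (by simp)).hom

/-- Only `j = 0` and `j = -1` have content, being homological degrees `0` and `1`; in positive
degrees both complexes are exact. -/
lemma quasiIsoAt_augCochain {j : ℤ} (hj : -1 ≤ j) : QuasiIsoAt R.augCochain j := by
  have h : ∀ k : ℕ, QuasiIsoAt R.augChain k → ∀ j : ℤ, -(k : ℤ) = j →
      QuasiIsoAt R.augCochain j := fun k hk j hkj => by
    have := (quasiIsoAt_extendMap_iff R.augChain ComplexShape.embeddingDownNat
      (j := k) (j' := j) (by simpa using hkj)).2 hk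
    exact quasiIsoAt_comp (hφ := this)
      (hφ' := (inferInstance : QuasiIso (extendSingleIso ComplexShape.embeddingDownNat
        (ModuleCat.of (Env F R.Alg) R.Alg) 0 (0 : ℤ) (by simp)).hom).quasiIsoAt j)
  rcases lt_trichotomy j 0 with hj' | rfl | hj'
  · exact h 1 R.quasiIsoAt_augChain_one j (by push_cast; omega)
  · exact h 0 R.quasiIsoAt_augChain_zero 0 (by simp)
  · rw [quasiIsoAt_iff_exactAt']
    · exact ExactAt.of_isZero (R.koszulComplex.isZero_extend_X _ _ fun i hi => by
        have : -(i : ℤ) = j := hi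
        omega)
    · exact regularComplex_exactAt F R.Alg hj'.ne'

lemma koszulCochainComplex_exactAt_iff {p : ℕ} {j : ℤ} (h : -(p : ℤ) = j) :
    R.koszulCochainComplex.ExactAt j ↔ R.koszulComplex.ExactAt p :=
  R.koszulComplex.extend_exactAt_iff ComplexShape.embeddingDownNat (by simpa using h)

lemma exactAt_of_calabiYau {n : ℕ} (hCY : IsCalabiYau F R.Alg n) (hKc : R.IsKcCalabiYau n)
    {i p : ℕ} (hi : i ≤ 1) (hp : i + p = n) (hp0 : p ≠ 0) : R.koszulComplex.ExactAt p := by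
  -- The cone of the augmentation sits in degrees `≤ -3`: the augmentation is a quasi-isomorphism
  -- from degree `-1` up, and `A` has no cohomology in degree `-2`. The resulting condition `-1 ≤
  -- -i` is `i ≤ 1`.
  have h := hKc.duality.exactAt_of_exactAt hCY.duality R.augCochain (-3)
    (fun j hj => R.quasiIsoAt_augCochain (by omega))
    (regularComplex_exactAt F R.Alg (by omega)) (i := i) (by omega)
    -- Degree `i` of a shift by `-n` is degree `i - n = -p`, where `A` has no cohomology as `p ≠ 0`.
    ((shift_exactAt_iff _ _ _ (-p) (by omega)).2
      (regularComplex_exactAt F R.Alg (by omega)))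
  exact (R.koszulCochainComplex_exactAt_iff rfl).1
    ((shift_exactAt_iff _ _ _ (-p) (by omega)).1 h)

end QuadraticRelations

end QuadraticQuiver

end

theorem mainTheorem11 {F : Type u} [Field F] {Q : Type u} [Quiver.{u} Q] [Fintype Q]
    [Fintype (Quiver.Total Q)] (R : QuadraticQuiver.QuadraticRelations F Q) (n : ℕ) (hn : n ≤ 3)
    (hCY : QuadraticQuiver.IsCalabiYau F R.Alg n) (hKcCY : R.IsKcCalabiYau n) :
    R.IsKoszul := by
  intro p hp
  by_cases h : n < p
  · exact HomologicalComplex.ExactAt.of_isZero (hKcCY.isZero_of_lt p h)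
  -- Here `2 ≤ p ≤ n ≤ 3`, so `n - p ≤ 1`; this is where the bound on `n` enters.
  · exact R.exactAt_of_calabiYau hCY hKcCY (i := n - p) (by omega) (by omega) (by omega)
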